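/- Let $d\ge 2$ be an integer and $c\in(0,1]$. Let $\overrightarrow{\mathbb T}_d$ be the rooted homogeneous tree in which every vertex has $d+1$ neighbours, with all edges directed away from the root (so the root has $d+1$ children and every other vertex has $d$ children). For $q\in(0,1)$ with $dq<1$, consider the following frog model on $\overrightarrow{\mathbb T}_d$. Each vertex $v$ carries one particle, a random walk $(S^v_n)_{n\ge0}$ on $\overrightarrow{\mathbb T}_d$ started at $v$ whose every step goes to a uniformly chosen child of the current vertex, and a lifetime $\mathcal T_v$ with values in $\{0,1,2,\dots\}$ and $\mathbb P(\mathcal T_v\ge n)=c(dq)^n$ for all $n\ge1$; all walks and lifetimes are independent. At time $0$ only the particle at the root is active. A particle activated at time $s$ is at $S^v_n$ at time $s+n$ for $0\le n\le\mathcal T_v$, activates the inactive particles at the vertices that it visits, and is removed after $\mathcal T_v$ steps. The model survives if at every time there is at least one active particle. Let $\theta(d,c,q)$ be the probability of survival, and let $$q_c=q_c(d,c):=\inf\{q>0:\ \theta(d,c,q)>0\},$$ the infimum being over those $q$ for which the model is defined. Then $q_c$ is the unique $q\in(0,1)$ such that the series below converges and $$\sum_{k\ge1}c(dq)^k\prod_{i=1}^{k-1}(1-cq^i)=1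 .$$ Moreover $q_c\in(0,1/d)$. -/

import Mathlib

open scoped ENNReal

noncomputable section

namespace FrogModel

/-- Vertices of the rooted homogeneous tree in which every vertex has `d + 1` neighbours: the root
has `d + 1` children, every other vertex has one parent and `d` children. The vertex `node i l` is
reached from the root by going first to the child number `i` and then following the directions
listed in `l`, the most recent one at the head of `l`. -/
inductive Vertex (d : ℕ) : Type
  | root : Vertex d
  | node (i : Fin (d + 1)) (l : List (Fin d)) : Vertex d

/-- Randomness for one jump: a direction to be used at the root, and a direction to be used at any
other vertex. -/
abbrev Direction (d : ℕ) : Type := Fin (d + 1) × Fin d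

/-- The child of a vertex in a given direction (the edges point away from the root). When the
direction is uniform, this is a uniformly chosen child of the vertex. -/
def Vertex.child {d : ℕ} : Vertex d → Direction d → Vertex d
  | .root, x => .node x.1 []
  | .node i l, x => .node i (x.2 :: l)

/-- A realization: for each vertex, the lifetime of its particle and the directions of the
successive jumps of its particle. -/
abbrev Config (d : ℕ) : Type := Vertex d → ℕ × (ℕ → Direction d)

/-- The lifetime `𝒯_v`, the number of steps made by the particle of `v` once it is active. -/
def lifetime {d : ℕ} (ω : Config d) (v : Vertex d) : ℕ := (ω v).1

/-- The random walk `(S_n^v)` of the particle that starts from `v`. -/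
def walk {d : ℕ} (ω : Config d) (v : Vertex d) : ℕ → Vertex d
  | 0 => v
  | n + 1 => (walk ω v n).child ((ω v).2 n)

/-- `ActivatedAt ω v t`: the particle of `v` is activated at time `t`. At time `0` only the particle
of the root is active; a particle activated at time `s` visits, at the times `s + n` with `n` at
most its lifetime, the vertices of its walk and activates the particles there. As all jumps lead
away from the root, a vertex at distance `t` from the root can be visited at time `t` only, so the
time of the first visit need not be singled out. -/
inductive ActivatedAt {d : ℕ} (ω : Config d) : Vertex d → ℕ → Prop
  | root : ActivatedAt ω Vertex.root 0
  | visit (u : Vertex d) (s n : ℕ) (hu : ActivatedAt ω u s) (hn : n ≤ lifetime ω u) :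
      ActivatedAt ω (walk ω u n) (s + n)

/-- The particle of `v` is active at time `t`: it has been activated and its lifetime has not
elapsed. -/
def ActiveAt {d : ℕ} (ω : Config d) (v : Vertex d) (t : ℕ) : Prop :=
  ∃ s, ActivatedAt ω v s ∧ s ≤ t ∧ t < s + lifetime ω v

/-- Survival: at any time there is at least one active particle. -/
def Survives {d : ℕ} (ω : Config d) : Prop := ∀ t : ℕ, ∃ v : Vertex d, ActiveAt ω v t

/-- The law of the model in which the lifetimes have law `ν`: all lifetimes and all jumps are
independent, and the jumps are uniform. -/
def frogMeasure (d : ℕ) [NeZero d] (ν : PMF ℕ) : MeasureTheory.Measure (Config d) :=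
  MeasureTheory.Measure.infinitePi fun _ : Vertex d =>
    ν.toMeasure.prod
      (MeasureTheory.Measure.infinitePi fun _ : ℕ =>
        (PMF.uniformOfFintype (Direction d)).toMeasure)

/-- The probability of survival when the lifetimes have law `ν`. -/
def survivalProb (d : ℕ) [NeZero d] (ν : PMF ℕ) : ℝ≥0∞ :=
  frogMeasure d ν {ω | Survives ω}

/-- The lifetime law: a law on `ℕ = {0, 1, 2, …}` with `ℙ(𝒯 ≥ n) = c (d q) ^ n` for `n ≥ 1`. -/
def IsLifetimeLaw (d : ℕ) (c q : ℝ) (ν : PMF ℕ) : Prop :=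
  ∀ n : ℕ, 1 ≤ n → ν.toMeasure {m | n ≤ m} = ENNReal.ofReal (c * (d * q) ^ n)

/-- The lifetime law is unique. -/
theorem IsLifetimeLaw.unique {d : ℕ} {c q : ℝ} {ν ν' : PMF ℕ} (h : IsLifetimeLaw d c q ν)
    (h' : IsLifetimeLaw d c q ν') : ν = ν' := by
  have key : ∀ n : ℕ, ν.toMeasure {m | n ≤ m} = ν'.toMeasure {m | n ≤ m} := by
    intro n
    rcases Nat.eq_zero_or_pos n with rfl | hn
    · simp
    · rw [h n hn, h' n hn]
  refine PMF.toMeasure_injective (MeasureTheory.Measure.ext_of_Ici _ _ fun n => ?_)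
  exact key n

/-- The lifetime law exists for `0 < c ≤ 1` and `0 ≤ d q < 1`. -/
theorem exists_isLifetimeLaw {d : ℕ} {c q : ℝ} (hc : 0 < c) (hc' : c ≤ 1) (hq : 0 ≤ d * q)
    (hq' : d * q < 1) : ∃ ν : PMF ℕ, IsLifetimeLaw d c q ν := by
  set r : ℝ := d * q with hr
  let g : ℕ → ℝ := fun n => if n = 0 then 1 else c * r ^ n
  have g0 : g 0 = 1 := by simp [g]
  have gpos : ∀ n, 1 ≤ n → g n = c * r ^ n := fun n hn => by
    simp [g, Nat.one_le_iff_ne_zero.mp hn]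
  have hanti : ∀ n, 0 ≤ g n - g (n + 1) := by
    intro n
    rcases Nat.eq_zero_or_pos n with rfl | hn
    · rw [g0, gpos 1 le_rfl]
      nlinarith
    · rw [gpos n hn, gpos (n + 1) (by omega), pow_succ]
      have : 0 ≤ c * r ^ n := by positivity
      nlinarith
  have hsum : ∀ n, ∑ i ∈ Finset.range n, ENNReal.ofReal (g i - g (i + 1))
      = ENNReal.ofReal (1 - g n) := by
    intro n
    rw [← ENNReal.ofReal_sum_of_nonneg fun i _ => hanti i, Finset.sum_range_sub', g0]
  have hlim : Filter.Tendsto g Filter.atTop (nhds 0) := by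
    have h1 := (tendsto_pow_atTop_nhds_zero_of_lt_one hq hq').const_mul c
    rw [mul_zero] at h1
    refine h1.congr' ?_
    filter_upwards [Filter.eventually_ge_atTop 1] with n hn
    exact (gpos n hn).symm
  have hs : HasSum (fun n => ENNReal.ofReal (g n - g (n + 1))) 1 := by
    rw [ENNReal.hasSum_iff_tendsto_nat]
    simp_rw [hsum]
    have h2 := ENNReal.tendsto_ofReal (hlim.const_sub 1)
    simpa using h2
  obtain ⟨ν, hν⟩ : ∃ ν : PMF ℕ, ∀ n, ν n = ENNReal.ofReal (g n - g (n + 1)) :=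
    ⟨⟨_, hs⟩, fun _ => rfl⟩
  refine ⟨ν, fun n hn => ?_⟩
  have hg1 : 0 ≤ g n ∧ g n ≤ 1 := by
    rw [gpos n hn]
    have : r ^ n ≤ 1 := pow_le_one₀ hq hq'.le
    exact ⟨by positivity, by nlinarith [pow_nonneg hq n]⟩
  have hset : {m : ℕ | n ≤ m} = (↑(Finset.range n) : Set ℕ)ᶜ := by
    ext m
    simp
  rw [hset, MeasureTheory.prob_compl_eq_one_sub (Finset.measurableSet _),
    PMF.toMeasure_apply_finset]
  simp_rw [hν]
  rw [hsum, ← gpos n hn, ← ENNReal.ofReal_one, ← ENNReal.ofReal_sub 1 (by linarith [hg1.2])]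
  congr 1
  ring

/-- The critical parameter `q_c(d, c) = inf {q > 0 : θ(d, c, q) > 0}`, where `q` ranges over the
parameters in `(0, 1)` for which the model is defined and `θ(d, c, q)` is the probability of
survival. -/
def criticalParam (d : ℕ) [NeZero d] (c : ℝ) : ℝ :=
  sInf {q : ℝ | 0 < q ∧ q < 1 ∧ (∀ n : ℕ, 1 ≤ n → c * (d * q) ^ n < 1) ∧
    ∃ ν : PMF ℕ, IsLifetimeLaw d c q ν ∧ 0 < survivalProb d ν}

end FrogModel

end

/-!
A vertex is activated if and only if its nearest ancestor whose particle, once active, reaches it is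
itself activated. The particles of different ancestors are independent, and the one `k` generations
above, unless it is that of the root, reaches the vertex with probability `c * q ^ k`. Hence the
probability that an active vertex other than the root leads to the activation of a given descendant
`n` generations below is the renewal sequence of the weights
`c * q ^ (k + 1) * ∏ i ∈ Finset.Icc 1 k, (1 - c * q ^ i)`, and, multiplied by `d ^ n`, it is the
renewal sequence of the terms of the series.

If the series sums to less than one, the expected number of activated vertices at level `n` tends to
zero. If it sums to more than one, then for some `N` an active vertex activates on average more than
one descendant `N` generations below. Observed every `N` generations, the model dominates a
branching process with this mean, and a second-order Bonferroni inequality bounds its survival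
probability from below uniformly in the number of generations. As each term of the series is
monotone in `q ∈ [0, 1 / 2]`, which contains `[0, 1 / d)`, the series takes the value one exactly
once.
-/

noncomputable section

namespace FrogModel

open Filter MeasureTheory ProbabilityTheory Topology

section RenewalSequence

/-- The renewal sequence with weights `f`, where `f k` is the weight of a step of length `k + 1`:
its `n`-th term is the sum, over all compositions of `n`, of the products of the weights of their
parts. -/
def renewalSeq (f : ℕ → ℝ) : ℕ → ℝ
  | 0 => 1
  | n + 1 => ∑ k : Fin (n + 1), renewalSeq f (n - k) * f k
decreasing_by omega

variable {f : ℕ → ℝ}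

@[simp] lemma renewalSeq_zero (f : ℕ → ℝ) : renewalSeq f 0 = 1 := by rw [renewalSeq]

lemma renewalSeq_succ (f : ℕ → ℝ) (n : ℕ) :
    renewalSeq f (n + 1) = ∑ k ∈ Finset.range (n + 1), renewalSeq f (n - k) * f k := by
  rw [renewalSeq, Finset.sum_range fun k => renewalSeq f (n - k) * f k]

lemma renewalSeq_nonneg (hf : ∀ k, 0 ≤ f k) (n : ℕ) : 0 ≤ renewalSeq f n := by
  induction n using Nat.strong_induction_on with
  | _ n ih =>
    rcases n with _ | n
    · simp
    · rw [renewalSeq_succ]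
      exact Finset.sum_nonneg fun k _ => mul_nonneg (ih _ (by omega)) (hf k)

lemma renewalSeq_pow_mul (s : ℝ) (f : ℕ → ℝ) (n : ℕ) :
    renewalSeq (fun k => s ^ (k + 1) * f k) n = s ^ n * renewalSeq f n := by
  induction n using Nat.strong_induction_on with
  | _ n ih =>
    rcases n with _ | n
    · simp
    · rw [renewalSeq_succ, renewalSeq_succ, Finset.mul_sum]
      refine Finset.sum_congr rfl fun k hk => ?_
      have hkn : n + 1 = (n - k) + (k + 1) := by have := Finset.mem_range.1 hk; omega
      rw [ih (n - k) (by omega), hkn, pow_add]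
      ring

lemma sum_range_renewalSeq_succ (f : ℕ → ℝ) (n : ℕ) :
    ∑ i ∈ Finset.range (n + 1), renewalSeq f i =
      ∑ k ∈ Finset.range n, f k * ∑ i ∈ Finset.range (n - k), renewalSeq f i + 1 := by
  rw [Finset.sum_range_succ', renewalSeq_zero]
  congr 1
  calc ∑ i ∈ Finset.range n, renewalSeq f (i + 1)
      = ∑ i ∈ Finset.range n, ∑ k ∈ Finset.range (i + 1), f k * renewalSeq f (i - k) := by
        simp only [renewalSeq_succ, mul_comm]
    _ = ∑ k ∈ Finset.range n, ∑ i ∈ Finset.range (n - k), f k * renewalSeq f i :=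
        Finset.sum_range_diag_flip n fun k i => f k * renewalSeq f i
    _ = _ := by simp only [Finset.mul_sum]

lemma monotone_sum_range_renewalSeq (hf : ∀ k, 0 ≤ f k) :
    Monotone fun n => ∑ i ∈ Finset.range n, renewalSeq f i :=
  fun _ _ h => Finset.sum_le_sum_of_subset_of_nonneg (Finset.range_mono h) fun i _ _ =>
    renewalSeq_nonneg hf i

lemma summable_renewalSeq (hf : ∀ k, 0 ≤ f k) (hs : Summable f) (hlt : ∑' k, f k < 1) :
    Summable (renewalSeq f) := by
  have hmono := monotone_sum_range_renewalSeq hf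
  refine summable_of_sum_range_le (c := 1 / (1 - ∑' k, f k)) (renewalSeq_nonneg hf) fun n => ?_
  set U := ∑ i ∈ Finset.range n, renewalSeq f i
  have hU : U ≤ (∑' k, f k) * U + 1 := by
    calc U ≤ ∑ i ∈ Finset.range (n + 1), renewalSeq f i := hmono n.le_succ
      _ = ∑ k ∈ Finset.range n, f k * ∑ i ∈ Finset.range (n - k), renewalSeq f i + 1 :=
          sum_range_renewalSeq_succ f n
      _ ≤ ∑ k ∈ Finset.range n, f k * U + 1 := by
          gcongr with k
          · exact hf k
          · exact hmono (n.sub_le k)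
      _ = (∑ k ∈ Finset.range n, f k) * U + 1 := by rw [Finset.sum_mul]
      _ ≤ (∑' k, f k) * U + 1 := by
          gcongr
          · exact Finset.sum_nonneg fun i _ => renewalSeq_nonneg hf i
          · exact hs.sum_le_tsum _ fun k _ => hf k
  rw [le_div_iff₀ (by linarith)]
  linarith

lemma sum_range_lt_one_of_summable_renewalSeq (hf : ∀ k, 0 ≤ f k) (hs : Summable (renewalSeq f))
    (K : ℕ) : ∑ k ∈ Finset.range K, f k < 1 := by
  set U := ∑' i, renewalSeq f i
  have hlim : Tendsto (fun n => ∑ i ∈ Finset.range n, renewalSeq f i) atTop (𝓝 U) :=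
    hs.hasSum.tendsto_sum_nat
  have hmono := monotone_sum_range_renewalSeq hf
  have hstep (n : ℕ) : (∑ k ∈ Finset.range K, f k) * ∑ i ∈ Finset.range n, renewalSeq f i + 1 ≤
      ∑ i ∈ Finset.range (n + K + 1), renewalSeq f i := by
    rw [sum_range_renewalSeq_succ, Finset.sum_mul]
    gcongr
    calc ∑ k ∈ Finset.range K, f k * ∑ i ∈ Finset.range n, renewalSeq f i
        ≤ ∑ k ∈ Finset.range K, f k * ∑ i ∈ Finset.range (n + K - k), renewalSeq f i := by
          refine Finset.sum_le_sum fun k hk => mul_le_mul_of_nonneg_left (hmono ?_) (hf k)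
          have := Finset.mem_range.1 hk
          omega
      _ ≤ _ := Finset.sum_le_sum_of_subset_of_nonneg (Finset.range_mono (by omega)) fun k _ _ =>
          mul_nonneg (hf k) (Finset.sum_nonneg fun i _ => renewalSeq_nonneg hf i)
  have hU : (∑ k ∈ Finset.range K, f k) * U + 1 ≤ U :=
    le_of_tendsto_of_tendsto' ((hlim.const_mul _).add_const 1)
      (hlim.comp (tendsto_add_atTop_nat (K + 1))) hstep
  have hU0 : 0 ≤ U := tsum_nonneg (renewalSeq_nonneg hf)
  by_contra! h
  nlinarith

-- If the sequence were bounded by `1`, then damping it by `s ^ n` with `s < 1` close to `1` would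
-- make it summable, whereas the damped weights would still have a sum exceeding `1`.
lemma exists_one_lt_renewalSeq (hf : ∀ k, 0 ≤ f k) {K : ℕ}
    (hK : 1 < ∑ k ∈ Finset.range K, f k) : ∃ n, 1 < renewalSeq f n := by
  by_contra! hle
  have hcont : Continuous fun s : ℝ => ∑ k ∈ Finset.range K, s ^ (k + 1) * f k := by fun_prop
  have hnear : ∀ᶠ s in 𝓝[<] (1 : ℝ), 1 < ∑ k ∈ Finset.range K, s ^ (k + 1) * f k :=
    nhdsWithin_le_nhds (hcont.continuousAt.eventually (lt_mem_nhds (by simpa using hK)))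
  obtain ⟨s, hs, hs0, hs1⟩ := (hnear.and (Ioo_mem_nhdsLT (zero_lt_one' ℝ))).exists
  have hg (k : ℕ) : 0 ≤ s ^ (k + 1) * f k := mul_nonneg (pow_nonneg hs0.le _) (hf k)
  have hsum : Summable (renewalSeq fun k => s ^ (k + 1) * f k) := by
    refine (summable_geometric_of_lt_one hs0.le hs1).of_nonneg_of_le (renewalSeq_nonneg hg)
      fun n => ?_
    rw [renewalSeq_pow_mul]
    exact mul_le_of_le_one_right (pow_nonneg hs0.le n) (hle n)
  exact hs.not_gt (sum_range_lt_one_of_summable_renewalSeq hg hsum K)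

end RenewalSequence

section Series

/-- The terms of the series that determines the critical parameter, for a tree in which the number
of vertices grows like `b ^ n`. -/
def seriesTerm (b c q : ℝ) (k : ℕ) : ℝ :=
  c * (b * q) ^ (k + 1) * ∏ i ∈ Finset.Icc 1 k, (1 - c * q ^ i)

variable {b c q : ℝ}

lemma exists_pos_le_prod_one_sub {a : ℕ → ℝ} (ha : ∀ i, 0 ≤ a i) (ha' : ∀ i, a i < 1)
    (hs : Summable a) : ∃ ε > 0, ∀ n, ε ≤ ∏ i ∈ Finset.range n, (1 - a i) := by
  have hlim : Tendsto (fun n => ∏ i ∈ Finset.range n, (1 - a i)) atTop (𝓝 (∏' i, (1 - a i))) := by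
    simpa only [sub_eq_add_neg] using
      (multipliable_one_add_of_summable (f := fun i => -a i) hs.neg.norm).hasProd.tendsto_prod_nat
  have hne : ∏' i, (1 - a i) ≠ 0 := by
    simpa only [sub_eq_add_neg] using tprod_one_add_ne_zero_of_summable (f := fun i => -a i)
      (fun i => ne_of_gt (by linarith [ha' i])) hs.neg.norm
  have hpos (n : ℕ) : 0 ≤ ∏ i ∈ Finset.range n, (1 - a i) :=
    Finset.prod_nonneg fun i _ => sub_nonneg.2 (ha' i).le
  have hanti : Antitone fun n => ∏ i ∈ Finset.range n, (1 - a i) :=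
    antitone_nat_of_succ_le fun n => by
      rw [Finset.prod_range_succ]
      exact mul_le_of_le_one_right (hpos n) (sub_le_self 1 (ha n))
  exact ⟨_, (ge_of_tendsto' hlim hpos).lt_of_ne' hne, hanti.le_of_tendsto hlim⟩

lemma one_sub_mul_pow_mem_Icc (hc : c ∈ Set.Icc (0 : ℝ) 1) (hq : q ∈ Set.Icc (0 : ℝ) 1) (i : ℕ) :
    1 - c * q ^ i ∈ Set.Icc (0 : ℝ) 1 :=
  ⟨sub_nonneg.2 (mul_le_one₀ hc.2 (pow_nonneg hq.1 i) (pow_le_one₀ hq.1 hq.2)),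
    sub_le_self 1 (mul_nonneg hc.1 (pow_nonneg hq.1 i))⟩

lemma prod_one_sub_mul_pow_mem_Icc (hc : c ∈ Set.Icc (0 : ℝ) 1) (hq : q ∈ Set.Icc (0 : ℝ) 1)
    (k : ℕ) : ∏ i ∈ Finset.Icc 1 k, (1 - c * q ^ i) ∈ Set.Icc (0 : ℝ) 1 :=
  have h i := one_sub_mul_pow_mem_Icc hc hq i
  ⟨Finset.prod_nonneg fun i _ => (h i).1,
    Finset.prod_le_one (fun i _ => (h i).1) fun i _ => (h i).2⟩

lemma seriesTerm_nonneg (hb : 0 ≤ b) (hc : c ∈ Set.Icc (0 : ℝ) 1) (hq : q ∈ Set.Icc (0 : ℝ) 1)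
    (k : ℕ) : 0 ≤ seriesTerm b c q k :=
  mul_nonneg (mul_nonneg hc.1 (pow_nonneg (mul_nonneg hb hq.1) _))
    (prod_one_sub_mul_pow_mem_Icc hc hq k).1

lemma seriesTerm_le_pow (hb : 0 ≤ b) (hc : c ∈ Set.Icc (0 : ℝ) 1) (hq : q ∈ Set.Icc (0 : ℝ) 1)
    (k : ℕ) : seriesTerm b c q k ≤ (b * q) ^ (k + 1) := by
  have hpow : 0 ≤ (b * q) ^ (k + 1) := pow_nonneg (mul_nonneg hb hq.1) _
  calc seriesTerm b c q k ≤ c * (b * q) ^ (k + 1) :=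
        mul_le_of_le_one_right (mul_nonneg hc.1 hpow) (prod_one_sub_mul_pow_mem_Icc hc hq k).2
    _ ≤ (b * q) ^ (k + 1) := mul_le_of_le_one_left hpow hc.2

lemma continuous_seriesTerm (b c : ℝ) (k : ℕ) : Continuous fun q => seriesTerm b c q k := by
  unfold seriesTerm
  fun_prop

lemma summable_pow_succ {r : ℝ} (h0 : 0 ≤ r) (h1 : r < 1) : Summable fun k : ℕ => r ^ (k + 1) :=
  (summable_nat_add_iff 1).2 (summable_geometric_of_lt_one h0 h1)

lemma mem_Icc_zero_one_of_mem_Ico (hb : 1 ≤ b) (hq : q ∈ Set.Ico 0 (1 / b)) :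
    q ∈ Set.Icc (0 : ℝ) 1 :=
  ⟨hq.1, hq.2.le.trans (div_le_self zero_le_one hb)⟩

lemma summable_seriesTerm (hb : 1 ≤ b) (hc : c ∈ Set.Icc (0 : ℝ) 1)
    (hq : q ∈ Set.Ico 0 (1 / b)) : Summable (seriesTerm b c q) := by
  have hb0 : 0 < b := zero_lt_one.trans_le hb
  have hq1 := mem_Icc_zero_one_of_mem_Ico hb hq
  exact (summable_pow_succ (mul_nonneg hb0.le hq.1) ((lt_div_iff₀' hb0).1 hq.2)).of_nonneg_of_le
    (seriesTerm_nonneg hb0.le hc hq1) (seriesTerm_le_pow hb0.le hc hq1)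

lemma exists_pos_le_seriesTerm (hc : c ∈ Set.Ioc (0 : ℝ) 1) (hq : q ∈ Set.Ico (0 : ℝ) 1)
    (hbq : 1 ≤ b * q) : ∃ ε > 0, ∀ k, ε ≤ seriesTerm b c q k := by
  obtain ⟨ε, hε, hle⟩ := exists_pos_le_prod_one_sub (a := fun i => c * q ^ (i + 1))
    (fun i => mul_nonneg hc.1.le (pow_nonneg hq.1 _))
    (fun i => mul_lt_one_of_nonneg_of_lt_one_right hc.2 (pow_nonneg hq.1 _)
      (pow_lt_one₀ hq.1 hq.2 i.succ_ne_zero))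
    ((summable_pow_succ hq.1 hq.2).mul_left c)
  refine ⟨c * ε, mul_pos hc.1 hε, fun k => ?_⟩
  have hprod : ε ≤ ∏ i ∈ Finset.Icc 1 k, (1 - c * q ^ i) := by
    simpa [← Finset.Ico_add_one_right_eq_Icc, Finset.prod_Ico_eq_prod_range, add_comm] using hle k
  rw [seriesTerm]
  gcongr
  · exact mul_nonneg hc.1.le (zero_le_one.trans (one_le_pow₀ hbq))
  · exact le_mul_of_one_le_right hc.1.le (one_le_pow₀ hbq)

lemma not_summable_seriesTerm (hc : c ∈ Set.Ioc (0 : ℝ) 1) (hq : q ∈ Set.Ico (0 : ℝ) 1)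
    (hbq : 1 ≤ b * q) : ¬ Summable (seriesTerm b c q) := by
  intro hs
  obtain ⟨ε, hε, hle⟩ := exists_pos_le_seriesTerm hc hq hbq
  exact hε.not_ge (ge_of_tendsto' hs.tendsto_atTop_zero hle)

-- `x - x ^ (i + 1)` is the product of `x * (1 - x)`, which increases up to `1 / 2`, with the
-- increasing function `1 + x + ⋯ + x ^ (i - 1)`.
lemma monotoneOn_sub_pow_succ (i : ℕ) :
    MonotoneOn (fun x : ℝ => x - x ^ (i + 1)) (Set.Icc 0 (1 / 2)) := by
  have hfactor (x : ℝ) : x - x ^ (i + 1) = x * (1 - x) * ∑ j ∈ Finset.range i, x ^ j := by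
    rw [mul_assoc, mul_comm (1 - x), geom_sum_mul_neg]
    ring
  intro x ⟨hx, _⟩ y ⟨_, hy⟩ hxy
  simp only [hfactor]
  gcongr ?_ * ∑ j ∈ Finset.range i, ?_ ^ j
  · exact mul_nonneg (hx.trans hxy) (by linarith)
  · nlinarith

lemma monotoneOn_mul_one_sub_mul_pow (hc : c ∈ Set.Icc (0 : ℝ) 1) (i : ℕ) :
    MonotoneOn (fun x : ℝ => x * (1 - c * x ^ i)) (Set.Icc 0 (1 / 2)) := by
  intro x hx y hy hxy
  calc x * (1 - c * x ^ i) = (1 - c) * x + c * (x - x ^ (i + 1)) := by ring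
    _ ≤ (1 - c) * y + c * (y - y ^ (i + 1)) :=
        add_le_add (mul_le_mul_of_nonneg_left hxy (sub_nonneg.2 hc.2))
          (mul_le_mul_of_nonneg_left (monotoneOn_sub_pow_succ i hx hy hxy) hc.1)
    _ = y * (1 - c * y ^ i) := by ring

lemma seriesTerm_eq_mul_prod (b c q : ℝ) (k : ℕ) :
    seriesTerm b c q k = c * b ^ (k + 1) * (q * ∏ i ∈ Finset.Icc 1 k, (q * (1 - c * q ^ i))) := by
  rw [seriesTerm, Finset.prod_mul_distrib, Finset.prod_const, Nat.card_Icc, Nat.add_sub_cancel]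
  ring

lemma monotoneOn_seriesTerm (hb : 0 ≤ b) (hc : c ∈ Set.Icc (0 : ℝ) 1) (k : ℕ) :
    MonotoneOn (fun q => seriesTerm b c q k) (Set.Icc 0 (1 / 2)) := by
  intro x hx y hy hxy
  have hfactor (i : ℕ) : 0 ≤ x * (1 - c * x ^ i) :=
    mul_nonneg hx.1 (one_sub_mul_pow_mem_Icc hc ⟨hx.1, hx.2.trans (by norm_num)⟩ i).1
  simp only [seriesTerm_eq_mul_prod]
  refine mul_le_mul_of_nonneg_left ?_ (mul_nonneg hc.1 (pow_nonneg hb _))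
  exact mul_le_mul hxy
    (Finset.prod_le_prod (fun i _ => hfactor i) fun i _ =>
      monotoneOn_mul_one_sub_mul_pow hc i hx hy hxy)
    (Finset.prod_nonneg fun i _ => hfactor i) hy.1

lemma strictMonoOn_tsum_seriesTerm (hb : 2 ≤ b) (hc : c ∈ Set.Ioc (0 : ℝ) 1) :
    StrictMonoOn (fun q => ∑' k, seriesTerm b c q k) (Set.Ico 0 (1 / b)) := by
  have hb1 : 1 ≤ b := one_le_two.trans hb
  have hc' : c ∈ Set.Icc (0 : ℝ) 1 := Set.Ioc_subset_Icc_self hc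
  have hsub : Set.Ico 0 (1 / b) ⊆ Set.Icc 0 (1 / 2) := Set.Ico_subset_Icc_self.trans
    (Set.Icc_subset_Icc_right (one_div_le_one_div_of_le two_pos hb))
  intro x hx y hy hxy
  refine Summable.tsum_lt_tsum (i := 0)
    (fun k => monotoneOn_seriesTerm (by linarith) hc' k (hsub hx) (hsub hy) hxy.le) ?_
    (summable_seriesTerm hb1 hc' hx) (summable_seriesTerm hb1 hc' hy)
  have hcb : c * b * x < c * b * y := by
    have := hc.1
    gcongr
  simpa [seriesTerm, mul_assoc] using hcb

lemma continuousOn_tsum_seriesTerm (hb : 1 ≤ b) (hc : c ∈ Set.Icc (0 : ℝ) 1)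
    (hq : q ∈ Set.Ico 0 (1 / b)) :
    ContinuousOn (fun x => ∑' k, seriesTerm b c x k) (Set.Icc 0 q) := by
  have hb0 : 0 < b := zero_lt_one.trans_le hb
  refine continuousOn_tsum (u := fun k => (b * q) ^ (k + 1))
    (fun k => (continuous_seriesTerm b c k).continuousOn)
    (summable_pow_succ (mul_nonneg hb0.le hq.1) ((lt_div_iff₀' hb0).1 hq.2)) fun k x hx => ?_
  have hx1 := mem_Icc_zero_one_of_mem_Ico hb ⟨hx.1, hx.2.trans_lt hq.2⟩
  rw [Real.norm_of_nonneg (seriesTerm_nonneg hb0.le hc hx1 k)]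
  calc seriesTerm b c x k ≤ (b * x) ^ (k + 1) := seriesTerm_le_pow hb0.le hc hx1 k
    _ ≤ (b * q) ^ (k + 1) := pow_le_pow_left₀ (mul_nonneg hb0.le hx.1)
        (mul_le_mul_of_nonneg_left hx.2 hb0.le) _

-- At `q = 1 / b` the terms are bounded away from zero, so some partial sum exceeds `1` there, and
-- hence also slightly to the left.
lemma exists_one_lt_tsum_seriesTerm (hb : 1 < b) (hc : c ∈ Set.Ioc (0 : ℝ) 1) :
    ∃ q ∈ Set.Ioo 0 (1 / b), 1 < ∑' k, seriesTerm b c q k := by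
  have hb0 : 0 < b := zero_lt_one.trans hb
  obtain ⟨ε, hε, hle⟩ := exists_pos_le_seriesTerm (b := b) (q := 1 / b) hc
    ⟨by positivity, (div_lt_one hb0).2 hb⟩ (mul_one_div_cancel hb0.ne').ge
  obtain ⟨K, hK⟩ := exists_nat_gt (1 / ε)
  have hlarge : 1 < ∑ k ∈ Finset.range K, seriesTerm b c (1 / b) k := calc
    1 < K * ε := (div_lt_iff₀ hε).1 hK
    _ ≤ ∑ k ∈ Finset.range K, seriesTerm b c (1 / b) k := by
      simpa using Finset.card_nsmul_le_sum (Finset.range K) _ ε fun k _ => hle k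
  have hcont : Continuous fun q => ∑ k ∈ Finset.range K, seriesTerm b c q k :=
    continuous_finsetSum _ fun k _ => continuous_seriesTerm b c k
  have hnear : ∀ᶠ q in 𝓝[<] (1 / b), 1 < ∑ k ∈ Finset.range K, seriesTerm b c q k :=
    nhdsWithin_le_nhds (hcont.continuousAt.eventually (lt_mem_nhds hlarge))
  obtain ⟨q, hlt, hq⟩ := (hnear.and (Ioo_mem_nhdsLT (one_div_pos.2 hb0))).exists
  have hc' : c ∈ Set.Icc (0 : ℝ) 1 := Set.Ioc_subset_Icc_self hc
  have hq' : q ∈ Set.Ico 0 (1 / b) := Set.Ioo_subset_Ico_self hq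
  exact ⟨q, hq, hlt.trans_le <| (summable_seriesTerm hb.le hc' hq').sum_le_tsum _ fun k _ =>
    seriesTerm_nonneg hb0.le hc' (mem_Icc_zero_one_of_mem_Ico hb.le hq') k⟩

lemma exists_tsum_seriesTerm_eq_one (hb : 1 < b) (hc : c ∈ Set.Ioc (0 : ℝ) 1) :
    ∃ q ∈ Set.Ioo 0 (1 / b), ∑' k, seriesTerm b c q k = 1 := by
  obtain ⟨r, hr, hlt⟩ := exists_one_lt_tsum_seriesTerm hb hc
  have hzero : ∑' k, seriesTerm b c 0 k = 0 := by simp [seriesTerm]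
  obtain ⟨q, hq, hsum⟩ := intermediate_value_Ioo hr.1.le
    (continuousOn_tsum_seriesTerm hb.le (Set.Ioc_subset_Icc_self hc) (Set.Ioo_subset_Ico_self hr))
    (show (1 : ℝ) ∈ Set.Ioo _ _ from ⟨hzero.trans_lt one_pos, hlt⟩)
  exact ⟨q, ⟨hq.1, hq.2.trans hr.2⟩, hsum⟩

end Series

section Probability

lemma measureReal_infinitePi_inter_of_disjoint {ι : Type*} {X : ι → Type*}
    [∀ i, MeasurableSpace (X i)] {μ : ∀ i, Measure (X i)} [∀ i, IsProbabilityMeasure (μ i)]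
    {S T : Set ι} (hST : Disjoint S T) {A B : Set (∀ i, X i)}
    (hA : MeasurableSet[cylinderEvents S] A) (hB : MeasurableSet[cylinderEvents T] B) :
    (Measure.infinitePi μ).real (A ∩ B) =
      (Measure.infinitePi μ).real A * (Measure.infinitePi μ).real B := by
  have hindep : Indep (cylinderEvents S) (cylinderEvents T) (Measure.infinitePi μ) := by
    refine indep_iSup_of_disjoint (fun i => (measurable_pi_apply i).comap_le) ?_ hST
    rw [← iIndepFun_iff_iIndep]
    exact iIndepFun_infinitePi (X := fun _ x => x) fun _ => measurable_id
  simp only [measureReal_def]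
  rw [(Indep_iff _ _ _).1 hindep A B hA hB, ENNReal.toReal_mul]

lemma toMeasure_uniformOfFintype_prod {α β : Type*} [Fintype α] [Nonempty α] [Fintype β]
    [Nonempty β] [MeasurableSpace (α × β)] [DiscreteMeasurableSpace (α × β)]
    (s : Finset α) (t : Finset β) :
    (PMF.uniformOfFintype (α × β)).toMeasure (s ×ˢ t : Set (α × β)) =
      (s.card / Fintype.card α) * (t.card / Fintype.card β) := by
  rw [← Finset.coe_product, PMF.toMeasure_apply_finset]
  simp only [PMF.uniformOfFintype_apply, Finset.sum_const, Finset.card_product, nsmul_eq_mul,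
    Fintype.card_prod, Nat.cast_mul]
  rw [ENNReal.mul_inv (by simp) (by simp), div_eq_mul_inv, div_eq_mul_inv]
  ring

variable {Ω W : Type*} {mΩ : MeasurableSpace Ω} {μ : Measure Ω} [IsFiniteMeasure μ] [Fintype W]
  {E : W → Set Ω}

lemma sum_measureReal_sub_le_measureReal_iUnion [DecidableEq W] (hE : ∀ w, MeasurableSet (E w)) :
    ∑ w, μ.real (E w) - ∑ w, ∑ w' ∈ Finset.univ.erase w, μ.real (E w ∩ E w') ≤
      μ.real (⋃ w, E w) := by
  let overlap (w : W) : Set Ω := ⋃ w' ∈ Finset.univ.erase w, E w ∩ E w'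
  have hoverlap (w : W) :
      μ.real (overlap w) ≤ ∑ w' ∈ Finset.univ.erase w, μ.real (E w ∩ E w') :=
    measureReal_biUnion_finset_le _ _
  have hmeas (w : W) : MeasurableSet (E w \ overlap w) :=
    (hE w).diff (Finset.measurableSet_biUnion _ fun w' _ => (hE w).inter (hE w'))
  have hdisj : Pairwise (Function.onFun Disjoint fun w => E w \ overlap w) := by
    intro w w' hne
    refine Set.disjoint_left.2 fun x hx hx' => hx.2 (Set.mem_biUnion (x := w') ?_ ⟨hx.1, hx'.1⟩)
    simpa using hne.symm
  calc ∑ w, μ.real (E w) - ∑ w, ∑ w' ∈ Finset.univ.erase w, μ.real (E w ∩ E w')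
      ≤ ∑ w, (μ.real (E w) - μ.real (overlap w)) := by
        rw [← Finset.sum_sub_distrib]
        gcongr with w
        exact hoverlap w
    _ ≤ ∑ w, μ.real (E w \ overlap w) := by
        gcongr with w
        exact le_measureReal_sdiff (measure_ne_top μ _)
    _ = μ.real (⋃ w, E w \ overlap w) := (measureReal_iUnion_fintype hdisj hmeas).symm
    _ ≤ μ.real (⋃ w, E w) := measureReal_mono (Set.iUnion_mono fun w => Set.sdiff_subset)

variable {a δ : ℝ} {p : W → ℝ}

lemma mul_sum_mul_one_sub_sum_le_measureReal_iUnion (hE : ∀ w, MeasurableSet (E w)) (ha : 0 ≤ a)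
    (hp : ∀ w, 0 ≤ p w) (hsingle : ∀ w, μ.real (E w) = a * p w)
    (hpair : ∀ w w', w ≠ w' → μ.real (E w ∩ E w') ≤ a * (p w * p w')) :
    a * ((∑ w, p w) * (1 - ∑ w, p w)) ≤ μ.real (⋃ w, E w) := by
  classical
  refine le_trans ?_ (sum_measureReal_sub_le_measureReal_iUnion hE)
  have hoverlap (w : W) :
      ∑ w' ∈ Finset.univ.erase w, μ.real (E w ∩ E w') ≤ a * (p w * ∑ w', p w') := calc
    _ ≤ ∑ w' ∈ Finset.univ.erase w, a * (p w * p w') :=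
        Finset.sum_le_sum fun w' hw' => hpair w w' (Finset.ne_of_mem_erase hw').symm
    _ ≤ ∑ w', a * (p w * p w') :=
        Finset.sum_le_sum_of_subset_of_nonneg (Finset.subset_univ _) fun w' _ _ =>
          mul_nonneg ha (mul_nonneg (hp w) (hp w'))
    _ = a * (p w * ∑ w', p w') := by simp only [Finset.mul_sum]
  calc a * ((∑ w, p w) * (1 - ∑ w, p w)) = ∑ w, a * p w - ∑ w, a * (p w * ∑ w', p w') := by
        rw [← Finset.mul_sum, ← Finset.mul_sum, ← Finset.sum_mul]
        ring
    _ ≤ _ := by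
        simp only [hsingle]
        gcongr with w
        exact hoverlap w

-- Either some `p w` exceeds `δ`, and `E w` alone suffices, or all of them lie between `a * δ` and
-- `δ`, so that the overlaps of the events `E w` are negligible.
lemma mul_le_measureReal_iUnion (hE : ∀ w, MeasurableSet (E w)) (ha : 0 < a) (hδ : 0 ≤ δ)
    (haδ : 1 ≤ Fintype.card W * a * (1 - Fintype.card W * δ)) (hp : ∀ w, a * δ ≤ p w)
    (hsingle : ∀ w, μ.real (E w) = a * p w)
    (hpair : ∀ w w', w ≠ w' → μ.real (E w ∩ E w') ≤ a * (p w * p w')) :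
    a * δ ≤ μ.real (⋃ w, E w) := by
  by_cases hlarge : ∃ w, δ < p w
  · obtain ⟨w, hw⟩ := hlarge
    calc a * δ ≤ a * p w := by gcongr
      _ = μ.real (E w) := (hsingle w).symm
      _ ≤ μ.real (⋃ w, E w) := measureReal_mono (Set.subset_iUnion E w)
  push Not at hlarge
  have hlower : Fintype.card W * (a * δ) ≤ ∑ w, p w := by
    simpa using Finset.card_nsmul_le_sum Finset.univ p (a * δ) fun w _ => hp w
  have hupper : ∑ w, p w ≤ Fintype.card W * δ := by
    simpa using Finset.sum_le_card_nsmul Finset.univ p δ fun w _ => hlarge w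
  have hpos : 0 < 1 - Fintype.card W * δ :=
    pos_of_mul_pos_right (zero_lt_one.trans_le haδ) (by positivity)
  have haδ0 : 0 ≤ a * δ := by positivity
  calc a * δ ≤ a * δ * (Fintype.card W * a * (1 - Fintype.card W * δ)) :=
        le_mul_of_one_le_right haδ0 haδ
    _ = a * (Fintype.card W * (a * δ) * (1 - Fintype.card W * δ)) := by ring
    _ ≤ a * ((∑ w, p w) * (1 - ∑ w, p w)) := by
        have hsum : 0 ≤ ∑ w, p w := Finset.sum_nonneg fun w _ => haδ0.trans (hp w)
        gcongr
    _ ≤ μ.real (⋃ w, E w) := mul_sum_mul_one_sub_sum_le_measureReal_iUnion hE ha.le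
        (fun w => haδ0.trans (hp w)) hsingle hpair

end Probability

variable {d : ℕ}

section Tree

namespace Vertex

/-- The distance of a vertex to the root. -/
def level : Vertex d → ℕ
  | .root => 0
  | .node _ l => l.length + 1

/-- The parent of a vertex; by convention the root is its own parent. -/
def parent : Vertex d → Vertex d
  | .root => .root
  | .node _ [] => .root
  | .node i (_ :: l) => .node i l

/-- The ancestor of a vertex `k` generations above it, or the root if `k` exceeds the level. -/
def ancestor (v : Vertex d) (k : ℕ) : Vertex d := parent^[k] v

@[simp] lemma ancestor_zero (v : Vertex d) : v.ancestor 0 = v := rfl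

lemma ancestor_succ (v : Vertex d) (k : ℕ) : v.ancestor (k + 1) = (v.ancestor k).parent :=
  Function.iterate_succ_apply' _ _ _

@[simp] lemma ancestor_ancestor (v : Vertex d) (j k : ℕ) :
    (v.ancestor j).ancestor k = v.ancestor (j + k) := by
  rw [add_comm]
  exact (Function.iterate_add_apply _ _ _ _).symm

@[simp] lemma parent_child (v : Vertex d) (x : Direction d) : (v.child x).parent = v := by
  cases v <;> rfl

lemma level_parent (v : Vertex d) : v.parent.level = v.level - 1 := by
  rcases v with _ | ⟨i, _ | ⟨a, l⟩⟩ <;> rfl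

@[simp] lemma level_child (v : Vertex d) (x : Direction d) :
    (v.child x).level = v.level + 1 := by
  cases v <;> rfl

@[simp] lemma level_ancestor (v : Vertex d) (k : ℕ) : (v.ancestor k).level = v.level - k := by
  induction k with
  | zero => rfl
  | succ k ih => rw [ancestor_succ, level_parent, ih, Nat.sub_sub]

lemma eq_root_of_level_eq_zero {v : Vertex d} (h : v.level = 0) : v = .root := by
  cases v with
  | root => rfl
  | node i l => exact absurd h l.length.succ_ne_zero

lemma ancestor_level (v : Vertex d) : v.ancestor v.level = .root :=
  eq_root_of_level_eq_zero (by rw [level_ancestor, Nat.sub_self])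

lemma exists_eq_node_of_level_eq {v : Vertex d} {n : ℕ} (h : v.level = n + 1) :
    ∃ i, ∃ w : Fin n → Fin d, v = .node i (List.ofFn w) := by
  cases v with
  | root => exact absurd h n.succ_ne_zero.symm
  | node i l =>
    obtain rfl : l.length = n := Nat.succ_injective h
    exact ⟨i, l.get, by rw [List.ofFn_get]⟩

instance : Countable (Vertex d) := by
  have hsurj : Function.Surjective fun o : Option (Fin (d + 1) × List (Fin d)) =>
      o.elim (root : Vertex d) fun p => node p.1 p.2
    | .root => ⟨none, rfl⟩
    | .node i l => ⟨some (i, l), rfl⟩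
  exact hsurj.countable

/-- The descendant of a vertex reached by following the directions listed in `w`, the last one at
the head of `w`. The directions are those of the vertices other than the root; at the root, the
first child is chosen instead. -/
def descend (v : Vertex d) (w : List (Fin d)) : Vertex d := w.foldr (fun a y => y.child (0, a)) v

@[simp] lemma level_descend (v : Vertex d) (w : List (Fin d)) :
    (v.descend w).level = v.level + w.length := by
  induction w with
  | nil => rfl
  | cons a w ih => exact (level_child _ _).trans (congrArg (· + 1) ih)

lemma ancestor_descend (v : Vertex d) (w : List (Fin d)) :
    (v.descend w).ancestor w.length = v := by
  induction w with
  | nil => rfl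
  | cons a w ih => exact (congrArg (ancestor · w.length) (parent_child _ _)).trans ih

lemma descend_ne_root {v : Vertex d} (hv : v ≠ .root) (w : List (Fin d)) :
    v.descend w ≠ .root := by
  refine mt (fun h => eq_root_of_level_eq_zero ?_) hv
  exact Nat.eq_zero_of_add_eq_zero_right ((level_descend v w).symm.trans (congrArg level h))

lemma descend_injective {v : Vertex d} (hv : v ≠ .root) : Function.Injective v.descend := by
  rcases v with _ | ⟨i, l⟩
  · contradiction
  have hdescend (w : List (Fin d)) : (node i l).descend w = .node i (w ++ l) := by
    induction w with
    | nil => rfl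
    | cons a w ih => exact congrArg (child · (0, a)) ih
  intro w w' h
  simpa [hdescend] using h

/-- The set of the descendants of a vertex, including the vertex itself. -/
def subtree (x : Vertex d) : Set (Vertex d) :=
  {z | x.level ≤ z.level ∧ z.ancestor (z.level - x.level) = x}

lemma disjoint_subtree {x y : Vertex d} (hl : x.level = y.level) (hne : x ≠ y) :
    Disjoint x.subtree y.subtree :=
  Set.disjoint_left.2 fun _ hx hy => hne (by rw [← hx.2, ← hy.2, hl])

lemma disjoint_level_preimage_Iio_subtree {x : Vertex d} {n : ℕ} (h : n ≤ x.level) :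
    Disjoint (level ⁻¹' Set.Iio n) x.subtree :=
  Set.disjoint_left.2 fun _ hn hx => (h.trans hx.1).not_gt hn

lemma subtree_subset_subtree {x y : Vertex d} (h : y ∈ x.subtree) : y.subtree ⊆ x.subtree := by
  rintro z ⟨hyz, hzy⟩
  refine ⟨h.1.trans hyz, ?_⟩
  rw [show z.level - x.level = z.level - y.level + (y.level - x.level) by have := h.1; omega,
    ← ancestor_ancestor, hzy, h.2]

lemma ancestor_descend_mem_subtree (v : Vertex d) (w : List (Fin d)) {k : ℕ} (hk : k ≤ w.length) :
    (v.descend w).ancestor k ∈ v.subtree := by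
  refine ⟨by rw [level_ancestor, level_descend]; omega, ?_⟩
  rw [ancestor_ancestor, level_ancestor, level_descend,
    show k + (v.level + w.length - k - v.level) = w.length by omega, ancestor_descend]

end Vertex

end Tree

section Activation

variable {ω : Config d} {y : Vertex d}

@[simp] lemma level_walk (ω : Config d) (u : Vertex d) (n : ℕ) :
    (walk ω u n).level = u.level + n := by
  induction n with
  | zero => rfl
  | succ n ih => rw [walk, Vertex.level_child, ih, add_assoc]

lemma ancestor_walk (ω : Config d) (u : Vertex d) (m n : ℕ) :
    (walk ω u (m + n)).ancestor n = walk ω u m := by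
  induction n with
  | zero => rfl
  | succ n ih =>
    rw [← ih, ← add_assoc, walk]
    exact congrArg (Vertex.ancestor · n) (Vertex.parent_child _ _)

lemma ancestor_walk_self (ω : Config d) (u : Vertex d) (n : ℕ) : (walk ω u n).ancestor n = u := by
  simpa only [zero_add, walk] using ancestor_walk ω u 0 n

/-- The particle of the ancestor of `y` that lies `k` generations above `y` visits `y` if it is
activated. -/
def ReachedFrom (ω : Config d) (y : Vertex d) (k : ℕ) : Prop :=
  k ≤ lifetime ω (y.ancestor k) ∧ walk ω (y.ancestor k) k = y

/-- Once the ancestor of `y` that lies `n` generations above `y` is activated, it and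
its descendants activate `y`. The encoding: every vertex strictly after that ancestor on the path
leading to `y` is reached from an earlier vertex of the path. -/
def ActivatedFrom (ω : Config d) (n : ℕ) (y : Vertex d) : Prop :=
  ∀ j < n, ∃ k, 1 ≤ k ∧ j + k ≤ n ∧ ReachedFrom ω (y.ancestor j) k

/-- The nearest ancestor whose particle reaches `y` is the one `k + 1` generations above `y`. -/
def NearestReachedFrom (ω : Config d) (y : Vertex d) (k : ℕ) : Prop :=
  ReachedFrom ω y (k + 1) ∧ ∀ j ∈ Finset.Icc 1 k, ¬ ReachedFrom ω y j

lemma ReachedFrom.ancestor {j k : ℕ} (h : ReachedFrom ω y (j + k)) :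
    ReachedFrom ω (y.ancestor j) k := by
  refine ⟨?_, ?_⟩ <;> rw [Vertex.ancestor_ancestor]
  · exact (Nat.le_add_left k j).trans h.1
  · rw [← ancestor_walk ω _ k j, add_comm k, h.2]

lemma reachedFrom_walk {u : Vertex d} {n : ℕ} (hn : n ≤ lifetime ω u) :
    ReachedFrom ω (walk ω u n) n := by
  rw [ReachedFrom, ancestor_walk_self]
  exact ⟨hn, rfl⟩

lemma ActivatedFrom.ancestor {n j : ℕ} (h : ActivatedFrom ω n y) :
    ActivatedFrom ω (n - j) (y.ancestor j) := by
  intro i hi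
  obtain ⟨k, hk, hkn, hreach⟩ := h (j + i) (by omega)
  exact ⟨k, hk, by omega, by rwa [Vertex.ancestor_ancestor]⟩

lemma ActivatedFrom.of_reachedFrom {n k : ℕ} (h : ActivatedFrom ω n (y.ancestor k))
    (hreach : ReachedFrom ω y k) : ActivatedFrom ω (n + k) y := by
  intro j hj
  rcases lt_or_ge j k with hjk | hkj
  · refine ⟨k - j, by omega, by omega, ReachedFrom.ancestor ?_⟩
    rwa [Nat.add_sub_cancel' hjk.le]
  · obtain ⟨i, hi, hin, hreach'⟩ := h (j - k) (by omega)
    rw [Vertex.ancestor_ancestor, Nat.add_sub_cancel' hkj] at hreach'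
    exact ⟨i, hi, by omega, hreach'⟩

lemma activatedFrom_zero : ActivatedFrom ω 0 y := fun _ h => absurd h (Nat.not_lt_zero _)

lemma activatedFrom_succ_iff {n : ℕ} :
    ActivatedFrom ω (n + 1) y ↔ ∃ k ∈ Finset.range (n + 1),
      ActivatedFrom ω (n - k) (y.ancestor (k + 1)) ∧ NearestReachedFrom ω y k := by
  classical
  constructor
  · intro h
    have hex : ∃ k, ReachedFrom ω y (k + 1) ∧ k ≤ n := by
      obtain ⟨k, hk, hkn, hreach⟩ := h 0 n.succ_pos
      exact ⟨k - 1, by rwa [Nat.sub_add_cancel hk], by omega⟩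
    obtain ⟨hreach, hle⟩ := Nat.find_spec hex
    refine ⟨Nat.find hex, Finset.mem_range.2 (by omega), ?_, hreach, fun j hj hreach' => ?_⟩
    · simpa only [Nat.add_sub_add_right] using h.ancestor (j := Nat.find hex + 1)
    · rw [Finset.mem_Icc] at hj
      refine Nat.find_min hex (m := j - 1) (by omega) ⟨?_, by omega⟩
      rwa [Nat.sub_add_cancel hj.1]
  · rintro ⟨k, hk, hact, hreach, -⟩
    rw [Finset.mem_range] at hk
    rw [show n + 1 = n - k + (k + 1) by omega]
    exact hact.of_reachedFrom hreach

lemma ActivatedAt.level_eq {t : ℕ} (h : ActivatedAt ω y t) : y.level = t := by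
  induction h with
  | root => rfl
  | visit u s n _ _ ih => rw [level_walk, ih]

lemma ActivatedAt.activatedFrom {t : ℕ} (h : ActivatedAt ω y t) : ActivatedFrom ω t y := by
  induction h with
  | root => exact activatedFrom_zero
  | visit u s n _ hn ih =>
    refine ActivatedFrom.of_reachedFrom ?_ (reachedFrom_walk hn)
    rwa [ancestor_walk_self]

lemma ActivatedAt.of_ancestor {n : ℕ} : ∀ {y : Vertex d} {s : ℕ},
    ActivatedAt ω (y.ancestor n) s → ActivatedFrom ω n y → ActivatedAt ω y (s + n) := by
  induction n using Nat.strong_induction_on with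
  | _ n ih =>
    intro y s hs hact
    rcases n with _ | n
    · exact hs
    obtain ⟨k, hk, hact', hreach, -⟩ := activatedFrom_succ_iff.1 hact
    rw [Finset.mem_range] at hk
    have hancestor : ActivatedAt ω (y.ancestor (k + 1)) (s + (n - k)) := by
      refine ih (n - k) (by omega) ?_ hact'
      rwa [Vertex.ancestor_ancestor, show k + 1 + (n - k) = n + 1 by omega]
    have hy := ActivatedAt.visit _ _ (k + 1) hancestor hreach.1
    rwa [hreach.2, show s + (n - k) + (k + 1) = s + (n + 1) by omega] at hy

lemma activatedAt_iff {t : ℕ} : ActivatedAt ω y t ↔ y.level = t ∧ ActivatedFrom ω t y := by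
  refine ⟨fun h => ⟨h.level_eq, h.activatedFrom⟩, ?_⟩
  rintro ⟨rfl, h⟩
  rw [← zero_add y.level]
  exact .of_ancestor (by rw [Vertex.ancestor_level]; exact .root) h

lemma exists_activatedAt_of_le {s t : ℕ} (hst : s ≤ t) (h : ∃ y, ActivatedAt ω y t) :
    ∃ y, ActivatedAt ω y s := by
  obtain ⟨y, hy⟩ := h
  refine ⟨y.ancestor (t - s), activatedAt_iff.2 ⟨?_, ?_⟩⟩
  · rw [Vertex.level_ancestor, hy.level_eq, Nat.sub_sub_self hst]
  · simpa only [Nat.sub_sub_self hst] using hy.activatedFrom.ancestor (j := t - s)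

lemma survives_iff : Survives ω ↔ ∀ t, ∃ y, ActivatedAt ω y t := by
  constructor
  · intro h t
    obtain ⟨v, s, hs, hst, ht⟩ := h t
    have hvisit := ActivatedAt.visit v s (t - s) hs (by omega)
    rw [Nat.add_sub_cancel' hst] at hvisit
    exact ⟨_, hvisit⟩
  · intro h t
    obtain ⟨y, hy⟩ := h (t + 1)
    obtain ⟨k, hk, hact, hreach, -⟩ := activatedFrom_succ_iff.1 hy.activatedFrom
    rw [Finset.mem_range] at hk
    refine ⟨y.ancestor (k + 1), t - k, activatedAt_iff.2 ⟨?_, hact⟩, Nat.sub_le t k, ?_⟩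
    · rw [Vertex.level_ancestor, hy.level_eq, Nat.add_sub_add_right]
    · have := hreach.1
      omega

end Activation

section Measurability

variable {ω : Config d} {y : Vertex d} {k : ℕ} {S : Set (Vertex d)}

/-- The directions that lead from the parent of `z` to `z`. -/
def stepSet (z : Vertex d) : Set (Direction d) := {x | z.parent.child x = z}

/-- The lifetimes and directions with which the particle of the ancestor of `y` that lies `k`
generations above `y` visits `y`. -/
def reachSet (y : Vertex d) (k : ℕ) : Set (ℕ × (ℕ → Direction d)) :=
  {m | k ≤ m} ×ˢ (Finset.range k : Set ℕ).pi fun j => stepSet (y.ancestor (k - 1 - j))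

lemma child_eq_iff {v z : Vertex d} {x : Direction d} :
    v.child x = z ↔ v = z.parent ∧ x ∈ stepSet z := by
  constructor
  · rintro rfl
    exact ⟨(Vertex.parent_child v x).symm, congrArg (Vertex.child · x) (Vertex.parent_child v x)⟩
  · rintro ⟨rfl, h⟩
    exact h

lemma walk_eq_iff {u : Vertex d} :
    walk ω u k = y ↔ u = y.ancestor k ∧ ∀ j < k, (ω u).2 j ∈ stepSet (y.ancestor (k - 1 - j)) := by
  induction k generalizing y with
  | zero => simp [walk]
  | succ k ih =>
    have hancestor : ∀ j < k, y.parent.ancestor (k - 1 - j) = y.ancestor (k - j) := fun j hj => by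
      rw [show k - j = k - 1 - j + 1 by omega]
      rfl
    rw [walk, child_eq_iff, ih, Nat.forall_lt_succ_right, and_assoc, Nat.add_sub_cancel,
      Nat.sub_self]
    exact and_congr_right fun _ =>
      and_congr_left fun _ => forall₂_congr fun j hj => by rw [hancestor j hj]

lemma reachedFrom_iff : ReachedFrom ω y k ↔ ω (y.ancestor k) ∈ reachSet y k := by
  simp [ReachedFrom, walk_eq_iff, reachSet, lifetime]

lemma measurableSet_reachSet (y : Vertex d) (k : ℕ) : MeasurableSet (reachSet y k) :=
  (MeasurableSet.of_discrete).prod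
    (MeasurableSet.pi (Finset.countable_toSet _) fun _ _ => MeasurableSet.of_discrete)

lemma measurableSet_reachedFrom (h : y.ancestor k ∈ S) :
    MeasurableSet[cylinderEvents S] {ω : Config d | ReachedFrom ω y k} := by
  simp only [reachedFrom_iff]
  exact measurable_cylinderEvent_apply h (measurableSet_reachSet y k)

lemma measurableSet_forall_not_reachedFrom (h : ∀ j ∈ Finset.Icc 1 k, y.ancestor j ∈ S) :
    MeasurableSet[cylinderEvents S]
      {ω : Config d | ∀ j ∈ Finset.Icc 1 k, ¬ ReachedFrom ω y j} := by
  simp only [Set.ofPred_forall]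
  exact Finset.measurableSet_biInter _ fun j hj => (measurableSet_reachedFrom (h j hj)).compl

lemma measurableSet_nearestReachedFrom (h : ∀ j ∈ Finset.Icc 1 (k + 1), y.ancestor j ∈ S) :
    MeasurableSet[cylinderEvents S] {ω : Config d | NearestReachedFrom ω y k} :=
  (measurableSet_reachedFrom (h (k + 1) (by simp))).inter
    (measurableSet_forall_not_reachedFrom fun j hj =>
      h j (Finset.Icc_subset_Icc_right k.le_succ hj))

lemma measurableSet_activatedFrom {n : ℕ} (h : ∀ k ∈ Finset.Icc 1 n, y.ancestor k ∈ S) :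
    MeasurableSet[cylinderEvents S] {ω : Config d | ActivatedFrom ω n y} := by
  simp only [ActivatedFrom, Set.ofPred_forall, Set.ofPred_exists]
  refine .iInter fun j => .iInter fun _ => .iUnion fun k => ?_
  by_cases hk : 1 ≤ k ∧ j + k ≤ n
  · have hmem : (y.ancestor j).ancestor k ∈ S := by
      rw [Vertex.ancestor_ancestor]
      exact h _ (Finset.mem_Icc.2 ⟨by omega, hk.2⟩)
    simpa only [hk.1, hk.2, true_and] using measurableSet_reachedFrom hmem
  · simp only [← and_assoc, hk, false_and]
    exact @MeasurableSet.empty _ (cylinderEvents S)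

lemma measurableSet_exists_activatedAt (t : ℕ) :
    MeasurableSet {ω : Config d | ∃ y, ActivatedAt ω y t} := by
  simp only [activatedAt_iff, Set.ofPred_exists]
  exact .iUnion fun y => (MeasurableSet.const _).inter
    (cylinderEvents_le_pi _ (measurableSet_activatedFrom (S := .univ) fun _ _ => Set.mem_univ _))

end Measurability

section ReachProbability

variable [NeZero d] {ν : PMF ℕ} {c q : ℝ} {y : Vertex d} {k : ℕ}

instance : IsProbabilityMeasure (frogMeasure d ν) := by
  unfold frogMeasure
  infer_instance

lemma measureReal_frogMeasure_inter_of_disjoint {S T : Set (Vertex d)} (hST : Disjoint S T)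
    {A B : Set (Config d)} (hA : MeasurableSet[cylinderEvents S] A)
    (hB : MeasurableSet[cylinderEvents T] B) :
    (frogMeasure d ν).real (A ∩ B) = (frogMeasure d ν).real A * (frogMeasure d ν).real B :=
  measureReal_infinitePi_inter_of_disjoint hST hA hB

/-- The law of the direction of one jump. -/
abbrev stepLaw (d : ℕ) [NeZero d] : Measure (Direction d) :=
  (PMF.uniformOfFintype (Direction d)).toMeasure

lemma stepLaw_stepSet_of_level_eq_one (hy : y.level = 1) :
    stepLaw d (stepSet y) = (d + 1 : ℝ≥0∞)⁻¹ := by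
  rcases y with _ | ⟨i, _ | ⟨a, l⟩⟩
  · simp [Vertex.level] at hy
  · have hset : stepSet (.node i [] : Vertex d) = {i} ×ˢ Set.univ := by
      ext ⟨x, x'⟩
      simp [stepSet, Vertex.parent, Vertex.child]
    rw [hset]
    simpa [ENNReal.div_self, NeZero.ne d] using
      toMeasure_uniformOfFintype_prod {i} (Finset.univ : Finset (Fin d))
  · simp [Vertex.level] at hy

lemma stepLaw_stepSet_of_two_le_level (hy : 2 ≤ y.level) :
    stepLaw d (stepSet y) = (d : ℝ≥0∞)⁻¹ := by
  rcases y with _ | ⟨i, _ | ⟨a, l⟩⟩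
  · simp [Vertex.level] at hy
  · simp [Vertex.level] at hy
  · have hset : stepSet (.node i (a :: l) : Vertex d) = Set.univ ×ˢ {a} := by
      ext ⟨x, x'⟩
      simp [stepSet, Vertex.parent, Vertex.child]
    rw [hset]
    simpa [ENNReal.div_self, NeZero.ne d] using
      toMeasure_uniformOfFintype_prod (Finset.univ : Finset (Fin (d + 1))) {a}

lemma stepLaw_stepSet_le (y : Vertex d) : stepLaw d (stepSet y) ≤ (d : ℝ≥0∞)⁻¹ := by
  rcases lt_trichotomy y.level 1 with h | h | h
  · have hempty : stepSet (.root : Vertex d) = ∅ := by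
      ext x
      simp [stepSet, Vertex.parent, Vertex.child]
    rw [Vertex.eq_root_of_level_eq_zero (Nat.lt_one_iff.1 h), hempty, measure_empty]
    exact zero_le
  · rw [stepLaw_stepSet_of_level_eq_one h]
    exact ENNReal.inv_le_inv.2 le_self_add
  · exact (stepLaw_stepSet_of_two_le_level h).le

lemma measure_reachedFrom (y : Vertex d) (k : ℕ) :
    frogMeasure d ν {ω | ReachedFrom ω y k} =
      ν.toMeasure {m | k ≤ m} * ∏ j ∈ Finset.range k, stepLaw d (stepSet (y.ancestor j)) := by
  have hpreimage :
      {ω : Config d | ReachedFrom ω y k} = (fun ω => ω (y.ancestor k)) ⁻¹' reachSet y k := by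
    ext ω
    exact reachedFrom_iff
  rw [hpreimage, frogMeasure, (measurePreserving_eval_infinitePi _ _).measure_preimage
      (measurableSet_reachSet y k).nullMeasurableSet, reachSet, Measure.prod_prod,
    Measure.infinitePi_pi _ fun _ _ => MeasurableSet.of_discrete,
    Finset.prod_range_reflect fun j => stepLaw d (stepSet (y.ancestor j))]

lemma ofReal_mul_mul_pow_mul_inv_pow (hc : 0 ≤ c) (hq : 0 ≤ q) (k : ℕ) :
    ENNReal.ofReal (c * (d * q) ^ k) * (d : ℝ≥0∞)⁻¹ ^ k = ENNReal.ofReal (c * q ^ k) := by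
  have hd : (d : ℝ≥0∞) * (d : ℝ≥0∞)⁻¹ = 1 :=
    ENNReal.mul_inv_cancel (NeZero.ne _) (ENNReal.natCast_ne_top d)
  rw [ENNReal.ofReal_mul hc, ENNReal.ofReal_mul hc, ENNReal.ofReal_pow (by positivity),
    ENNReal.ofReal_pow hq, mul_assoc, ← mul_pow, ENNReal.ofReal_mul (by positivity),
    ENNReal.ofReal_natCast, mul_right_comm, hd, one_mul]

lemma measureReal_reachedFrom_le (hν : IsLifetimeLaw d c q ν) (hc : 0 ≤ c) (hq : 0 ≤ q)
    (hk : 1 ≤ k) : (frogMeasure d ν).real {ω | ReachedFrom ω y k} ≤ c * q ^ k := by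
  refine ENNReal.toReal_le_of_le_ofReal (by positivity) ?_
  rw [measure_reachedFrom, hν k hk, ← ofReal_mul_mul_pow_mul_inv_pow (d := d) hc hq]
  gcongr
  simpa using Finset.prod_le_pow_card (Finset.range k) (fun j => stepLaw d (stepSet (y.ancestor j)))
    _ fun j _ => stepLaw_stepSet_le _

lemma measureReal_reachedFrom (hν : IsLifetimeLaw d c q ν) (hc : 0 ≤ c) (hq : 0 ≤ q)
    (hk : 1 ≤ k) (hky : k < y.level) :
    (frogMeasure d ν).real {ω | ReachedFrom ω y k} = c * q ^ k := by
  have hstep : ∀ j ∈ Finset.range k, stepLaw d (stepSet (y.ancestor j)) = (d : ℝ≥0∞)⁻¹ := by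
    intro j hj
    rw [Finset.mem_range] at hj
    exact stepLaw_stepSet_of_two_le_level (by rw [Vertex.level_ancestor]; omega)
  rw [measureReal_def, measure_reachedFrom, hν k hk, Finset.prod_congr rfl hstep,
    Finset.prod_const, Finset.card_range, ofReal_mul_mul_pow_mul_inv_pow hc hq,
    ENNReal.toReal_ofReal (by positivity)]

lemma measureReal_reachedFrom_one_pos (hν : IsLifetimeLaw d c q ν) (hc : 0 < c) (hq : 0 < q)
    (hy : y.level = 1) : 0 < (frogMeasure d ν).real {ω | ReachedFrom ω y 1} := by
  have hd : (0 : ℝ) < d := Nat.cast_pos.2 (NeZero.pos d)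
  refine measureReal_nonneg.lt_of_ne' ?_
  rw [measureReal_def, measure_reachedFrom, hν 1 le_rfl, Finset.prod_range_one,
    Vertex.ancestor_zero, stepLaw_stepSet_of_level_eq_one hy, ENNReal.toReal_mul,
    ENNReal.toReal_ofReal (by positivity), ENNReal.toReal_inv,
    ENNReal.toReal_add (ENNReal.natCast_ne_top d) ENNReal.one_ne_top]
  positivity

end ReachProbability

section Renewal

variable {c q : ℝ} {y : Vertex d} {k n : ℕ}

/-- The probability that the nearest ancestor whose particle reaches a given vertex is the one
`k + 1` generations above it, provided that this ancestor is not the root. -/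
def gapProb (c q : ℝ) (k : ℕ) : ℝ := c * q ^ (k + 1) * ∏ i ∈ Finset.Icc 1 k, (1 - c * q ^ i)

lemma seriesTerm_eq_pow_mul_gapProb (b c q : ℝ) :
    seriesTerm b c q = fun k => b ^ (k + 1) * gapProb c q k := by
  ext k
  rw [seriesTerm, gapProb]
  ring

lemma ancestor_mem_level_preimage_Ioi (hk : k < y.level) :
    ∀ j ∈ Finset.Icc 1 k, y.ancestor j ∈ Vertex.level ⁻¹' Set.Ioi (y.level - (k + 1)) := by
  intro j hj
  rw [Finset.mem_Icc] at hj
  rw [Set.mem_preimage, Vertex.level_ancestor, Set.mem_Ioi]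
  omega

lemma pairwiseDisjoint_nearestReachedFrom (y : Vertex d) :
    Pairwise (Function.onFun Disjoint fun k => {ω : Config d | NearestReachedFrom ω y k}) := by
  refine (pairwise_disjoint_on _).2 fun j k hjk => ?_
  refine Set.disjoint_left.2 fun ω hj hk => hk.2 (j + 1) (Finset.mem_Icc.2 ?_) hj.1
  omega

variable [NeZero d] {ν : PMF ℕ}

-- The ancestors of `y` lie at distinct levels, so their particles reach `y` independently.
lemma measureReal_forall_not_reachedFrom_inter (hk : k < y.level) {A : Set (Config d)}
    (hA : MeasurableSet[cylinderEvents {y.ancestor (k + 1)}] A) :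
    (frogMeasure d ν).real ({ω | ∀ j ∈ Finset.Icc 1 k, ¬ ReachedFrom ω y j} ∩ A) =
      (frogMeasure d ν).real {ω | ∀ j ∈ Finset.Icc 1 k, ¬ ReachedFrom ω y j} *
        (frogMeasure d ν).real A := by
  refine measureReal_frogMeasure_inter_of_disjoint ?_
    (measurableSet_forall_not_reachedFrom (ancestor_mem_level_preimage_Ioi hk)) hA
  rw [Set.disjoint_singleton_right, Set.mem_preimage, Vertex.level_ancestor, Set.mem_Ioi]
  exact lt_irrefl _

lemma measureReal_not_reachedFrom (y : Vertex d) (k : ℕ) :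
    (frogMeasure d ν).real {ω | ¬ ReachedFrom ω y k} =
      1 - (frogMeasure d ν).real {ω | ReachedFrom ω y k} :=
  probReal_compl_eq_one_sub
    (cylinderEvents_le_pi _ (measurableSet_reachedFrom (S := .univ) (Set.mem_univ _)))

lemma measureReal_forall_not_reachedFrom (hk : k ≤ y.level) :
    (frogMeasure d ν).real {ω | ∀ j ∈ Finset.Icc 1 k, ¬ ReachedFrom ω y j} =
      ∏ j ∈ Finset.Icc 1 k, (1 - (frogMeasure d ν).real {ω | ReachedFrom ω y j}) := by
  induction k with
  | zero => simp
  | succ k ih =>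
    have hinter : {ω : Config d | ∀ j ∈ Finset.Icc 1 (k + 1), ¬ ReachedFrom ω y j} =
        {ω | ∀ j ∈ Finset.Icc 1 k, ¬ ReachedFrom ω y j} ∩ {ω | ¬ ReachedFrom ω y (k + 1)} := by
      ext ω
      simp [← Finset.insert_Icc_right_eq_Icc_add_one (Nat.le_add_left 1 k), and_comm]
    have hmeas : MeasurableSet[cylinderEvents {y.ancestor (k + 1)}]
        {ω : Config d | ¬ ReachedFrom ω y (k + 1)} :=
      (measurableSet_reachedFrom (Set.mem_singleton _)).compl
    rw [hinter, measureReal_forall_not_reachedFrom_inter hk hmeas, ih (Nat.le_of_succ_le hk),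
      measureReal_not_reachedFrom,
      Finset.prod_Icc_succ_top (Nat.le_add_left 1 k)]

lemma measureReal_forall_not_reachedFrom_eq_prod (hν : IsLifetimeLaw d c q ν) (hc : 0 ≤ c)
    (hq : 0 ≤ q) (hk : k < y.level) :
    (frogMeasure d ν).real {ω | ∀ j ∈ Finset.Icc 1 k, ¬ ReachedFrom ω y j} =
      ∏ i ∈ Finset.Icc 1 k, (1 - c * q ^ i) := by
  rw [measureReal_forall_not_reachedFrom hk.le]
  refine Finset.prod_congr rfl fun j hj => ?_
  rw [Finset.mem_Icc] at hj
  rw [measureReal_reachedFrom hν hc hq hj.1 (hj.2.trans_lt hk)]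

lemma measureReal_nearestReachedFrom (hν : IsLifetimeLaw d c q ν) (hc : 0 ≤ c) (hq : 0 ≤ q)
    (hk : k < y.level) :
    (frogMeasure d ν).real {ω | NearestReachedFrom ω y k} =
      (frogMeasure d ν).real {ω | ReachedFrom ω y (k + 1)} *
        ∏ i ∈ Finset.Icc 1 k, (1 - c * q ^ i) := by
  have hinter : {ω : Config d | NearestReachedFrom ω y k} =
      {ω | ∀ j ∈ Finset.Icc 1 k, ¬ ReachedFrom ω y j} ∩ {ω | ReachedFrom ω y (k + 1)} :=
    Set.inter_comm _ _
  rw [hinter,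
    measureReal_forall_not_reachedFrom_inter hk (measurableSet_reachedFrom (Set.mem_singleton _)),
    measureReal_forall_not_reachedFrom_eq_prod hν hc hq hk, mul_comm]

lemma measureReal_nearestReachedFrom_eq_gapProb (hν : IsLifetimeLaw d c q ν) (hc : 0 ≤ c)
    (hq : 0 ≤ q) (hk : k + 1 < y.level) :
    (frogMeasure d ν).real {ω | NearestReachedFrom ω y k} = gapProb c q k := by
  rw [measureReal_nearestReachedFrom hν hc hq (Nat.lt_of_succ_lt hk),
    measureReal_reachedFrom hν hc hq (Nat.le_add_left 1 k) hk, gapProb]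

lemma measureReal_nearestReachedFrom_le_gapProb (hν : IsLifetimeLaw d c q ν) (hc : 0 ≤ c)
    (hq : 0 ≤ q) (hk : k < y.level) :
    (frogMeasure d ν).real {ω | NearestReachedFrom ω y k} ≤ gapProb c q k := by
  rw [measureReal_nearestReachedFrom hν hc hq hk, gapProb]
  refine mul_le_mul_of_nonneg_right (measureReal_reachedFrom_le hν hc hq (Nat.le_add_left 1 k)) ?_
  rw [← measureReal_forall_not_reachedFrom_eq_prod hν hc hq hk]
  exact measureReal_nonneg

lemma measureReal_activatedFrom_inter_nearestReachedFrom (hk : k ≤ n) (hn : n < y.level) :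
    (frogMeasure d ν).real ({ω | ActivatedFrom ω (n - k) (y.ancestor (k + 1))} ∩
        {ω | NearestReachedFrom ω y k}) =
      (frogMeasure d ν).real {ω | ActivatedFrom ω (n - k) (y.ancestor (k + 1))} *
        (frogMeasure d ν).real {ω | NearestReachedFrom ω y k} := by
  refine measureReal_frogMeasure_inter_of_disjoint
    (S := Vertex.level ⁻¹' Set.Iio (y.level - (k + 1)))
    (T := Vertex.level ⁻¹' Set.Ici (y.level - (k + 1)))
    ((Set.Iio_disjoint_Ici le_rfl).preimage _)
    (measurableSet_activatedFrom fun j hj => ?_) (measurableSet_nearestReachedFrom fun j hj => ?_)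
  all_goals
    rw [Finset.mem_Icc] at hj
    simp only [Set.mem_preimage, Vertex.level_ancestor, Set.mem_Iio, Set.mem_Ici]
    omega

lemma measureReal_activatedFrom_succ (hn : n < y.level) :
    (frogMeasure d ν).real {ω | ActivatedFrom ω (n + 1) y} =
      ∑ k ∈ Finset.range (n + 1),
        (frogMeasure d ν).real {ω | ActivatedFrom ω (n - k) (y.ancestor (k + 1))} *
          (frogMeasure d ν).real {ω | NearestReachedFrom ω y k} := by
  have hunion : {ω : Config d | ActivatedFrom ω (n + 1) y} = ⋃ k ∈ Finset.range (n + 1),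
      {ω | ActivatedFrom ω (n - k) (y.ancestor (k + 1))} ∩ {ω | NearestReachedFrom ω y k} := by
    ext ω
    simp only [Set.mem_ofPred_eq, activatedFrom_succ_iff, Set.mem_iUnion, Set.mem_inter_iff,
      exists_prop]
  rw [hunion, measureReal_biUnion_finset]
  · refine Finset.sum_congr rfl fun k hk => ?_
    exact measureReal_activatedFrom_inter_nearestReachedFrom
      (Nat.lt_succ_iff.1 (Finset.mem_range.1 hk)) hn
  · exact fun j _ k _ hjk => (pairwiseDisjoint_nearestReachedFrom y hjk).mono
      Set.inter_subset_right Set.inter_subset_right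
  · exact fun k _ => .inter
      (cylinderEvents_le_pi _ (measurableSet_activatedFrom (S := .univ) fun _ _ => Set.mem_univ _))
      (cylinderEvents_le_pi _
        (measurableSet_nearestReachedFrom (S := .univ) fun _ _ => Set.mem_univ _))

lemma measureReal_activatedFrom (hν : IsLifetimeLaw d c q ν) (hc : 0 ≤ c) (hq : 0 ≤ q)
    (hn : n < y.level) :
    (frogMeasure d ν).real {ω | ActivatedFrom ω n y} = renewalSeq (gapProb c q) n := by
  induction n using Nat.strong_induction_on generalizing y with
  | _ n ih =>
    rcases n with _ | n
    · simp [activatedFrom_zero]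
    rw [measureReal_activatedFrom_succ (Nat.lt_of_succ_lt hn), renewalSeq_succ]
    refine Finset.sum_congr rfl fun k hk => ?_
    rw [Finset.mem_range] at hk
    rw [ih (n - k) (by omega) (by rw [Vertex.level_ancestor]; omega),
      measureReal_nearestReachedFrom_eq_gapProb hν hc hq (by omega)]

lemma measureReal_activatedFrom_le (hν : IsLifetimeLaw d c q ν) (hc : 0 ≤ c) (hq : 0 ≤ q)
    (hn : n ≤ y.level) :
    (frogMeasure d ν).real {ω | ActivatedFrom ω n y} ≤ renewalSeq (gapProb c q) n := by
  induction n using Nat.strong_induction_on generalizing y with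
  | _ n ih =>
    rcases n with _ | n
    · simp [activatedFrom_zero]
    rw [measureReal_activatedFrom_succ hn, renewalSeq_succ]
    refine Finset.sum_le_sum fun k hk => ?_
    rw [Finset.mem_range] at hk
    have hact := ih (n - k) (by omega) (y := y.ancestor (k + 1))
      (by rw [Vertex.level_ancestor]; omega)
    exact mul_le_mul hact (measureReal_nearestReachedFrom_le_gapProb hν hc hq (by omega))
      measureReal_nonneg (measureReal_nonneg.trans hact)

end Renewal

section EmbeddedProcess

variable {N : ℕ}

/-- The embedded branching process started from the activation of a vertex, observed every `N`
generations and forgetting the earlier particles at each observation, lasts for a given number of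
observations. -/
def embeddedSurvival (N : ℕ) : ℕ → Vertex d → Set (Config d)
  | 0, _ => Set.univ
  | n + 1, x => ⋃ w : Fin N → Fin d, {ω | ActivatedFrom ω N (x.descend (List.ofFn w))} ∩
      embeddedSurvival N n (x.descend (List.ofFn w))

lemma disjoint_level_preimage_Iio_subtree_descend (x : Vertex d) (w : Fin N → Fin d) :
    Disjoint (Vertex.level ⁻¹' Set.Iio (x.level + N)) (x.descend (List.ofFn w)).subtree :=
  Vertex.disjoint_level_preimage_Iio_subtree (by rw [Vertex.level_descend, List.length_ofFn])

lemma measurableSet_activatedFrom_descend (x : Vertex d) (w : Fin N → Fin d) :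
    MeasurableSet[cylinderEvents (Vertex.level ⁻¹' Set.Iio (x.level + N))]
      {ω | ActivatedFrom ω N (x.descend (List.ofFn w))} := by
  refine measurableSet_activatedFrom fun k hk => ?_
  rw [Finset.mem_Icc] at hk
  rw [Set.mem_preimage, Vertex.level_ancestor, Vertex.level_descend, List.length_ofFn, Set.mem_Iio]
  omega

lemma measurableSet_embeddedSurvival (n : ℕ) (x : Vertex d) :
    MeasurableSet[cylinderEvents x.subtree] (embeddedSurvival N n x) := by
  induction n generalizing x with
  | zero => exact MeasurableSet.univ
  | succ n ih =>
    refine MeasurableSet.iUnion fun w => .inter (measurableSet_activatedFrom fun k hk => ?_) ?_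
    · exact x.ancestor_descend_mem_subtree _ (by simpa using (Finset.mem_Icc.1 hk).2)
    · refine cylinderEvents_mono (Vertex.subtree_subset_subtree ?_) _ (ih _)
      exact x.ancestor_descend_mem_subtree _ (Nat.zero_le _)

lemma exists_activatedAt_of_mem_embeddedSurvival {ω : Config d} {n s : ℕ} {x : Vertex d}
    (hω : ω ∈ embeddedSurvival N n x) (hx : ActivatedAt ω x s) :
    ∃ y, ActivatedAt ω y (s + n * N) := by
  induction n generalizing x s with
  | zero => exact ⟨x, by simpa using hx⟩
  | succ n ih =>
    obtain ⟨w, hact, hsurv⟩ := Set.mem_iUnion.1 hω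
    have hancestor : (x.descend (List.ofFn w)).ancestor N = x := by
      simpa only [List.length_ofFn] using x.ancestor_descend (List.ofFn w)
    obtain ⟨y, hy⟩ := ih hsurv (.of_ancestor (n := N) (by rwa [hancestor]) hact)
    exact ⟨y, by rwa [Nat.succ_mul, add_comm (n * N), ← add_assoc]⟩

variable [NeZero d] {ν : PMF ℕ} {c q : ℝ} {x : Vertex d} {n : ℕ}

lemma measureReal_activatedFrom_descend (hν : IsLifetimeLaw d c q ν) (hc : 0 ≤ c) (hq : 0 ≤ q)
    (hx : x ≠ .root) (w : Fin N → Fin d) :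
    (frogMeasure d ν).real {ω | ActivatedFrom ω N (x.descend (List.ofFn w))} =
      renewalSeq (gapProb c q) N := by
  refine measureReal_activatedFrom hν hc hq ?_
  have := mt Vertex.eq_root_of_level_eq_zero hx
  rw [Vertex.level_descend, List.length_ofFn]
  omega

lemma measureReal_activatedFrom_descend_inter {w : Fin N → Fin d} {T : Set (Vertex d)}
    (hT : Disjoint (Vertex.level ⁻¹' Set.Iio (x.level + N)) T) {A : Set (Config d)}
    (hA : MeasurableSet[cylinderEvents T] A) :
    (frogMeasure d ν).real ({ω | ActivatedFrom ω N (x.descend (List.ofFn w))} ∩ A) =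
      (frogMeasure d ν).real {ω | ActivatedFrom ω N (x.descend (List.ofFn w))} *
        (frogMeasure d ν).real A :=
  measureReal_frogMeasure_inter_of_disjoint hT (measurableSet_activatedFrom_descend x w) hA

lemma measureReal_embeddedSurvival_inter (hx : x ≠ .root) {w w' : Fin N → Fin d} (hne : w ≠ w') :
    (frogMeasure d ν).real (embeddedSurvival N n (x.descend (List.ofFn w)) ∩
        embeddedSurvival N n (x.descend (List.ofFn w'))) =
      (frogMeasure d ν).real (embeddedSurvival N n (x.descend (List.ofFn w))) *
        (frogMeasure d ν).real (embeddedSurvival N n (x.descend (List.ofFn w'))) := by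
  refine measureReal_frogMeasure_inter_of_disjoint (Vertex.disjoint_subtree ?_ ?_)
    (measurableSet_embeddedSurvival n _) (measurableSet_embeddedSurvival n _)
  · simp only [Vertex.level_descend, List.length_ofFn]
  · exact (Vertex.descend_injective hx).ne (List.ofFn_injective.ne hne)

lemma measureReal_activatedFrom_descend_inter_embeddedSurvival (hν : IsLifetimeLaw d c q ν)
    (hc : 0 ≤ c) (hq : 0 ≤ q) (hx : x ≠ .root) (w : Fin N → Fin d) :
    (frogMeasure d ν).real ({ω | ActivatedFrom ω N (x.descend (List.ofFn w))} ∩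
        embeddedSurvival N n (x.descend (List.ofFn w))) =
      renewalSeq (gapProb c q) N *
        (frogMeasure d ν).real (embeddedSurvival N n (x.descend (List.ofFn w))) := by
  rw [measureReal_activatedFrom_descend_inter (disjoint_level_preimage_Iio_subtree_descend x w)
    (measurableSet_embeddedSurvival n _), measureReal_activatedFrom_descend hν hc hq hx]

lemma measureReal_inter_activatedFrom_descend_inter_embeddedSurvival_le
    (hν : IsLifetimeLaw d c q ν) (hc : 0 ≤ c) (hq : 0 ≤ q) (hx : x ≠ .root)
    {w w' : Fin N → Fin d} (hne : w ≠ w') :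
    (frogMeasure d ν).real
        (({ω | ActivatedFrom ω N (x.descend (List.ofFn w))} ∩
          embeddedSurvival N n (x.descend (List.ofFn w))) ∩
        ({ω | ActivatedFrom ω N (x.descend (List.ofFn w'))} ∩
          embeddedSurvival N n (x.descend (List.ofFn w')))) ≤
      renewalSeq (gapProb c q) N *
        ((frogMeasure d ν).real (embeddedSurvival N n (x.descend (List.ofFn w))) *
          (frogMeasure d ν).real (embeddedSurvival N n (x.descend (List.ofFn w')))) := by
  have hmeas : MeasurableSet[cylinderEvents
      ((x.descend (List.ofFn w)).subtree ∪ (x.descend (List.ofFn w')).subtree)]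
      (embeddedSurvival N n (x.descend (List.ofFn w)) ∩
        embeddedSurvival N n (x.descend (List.ofFn w'))) :=
    .inter (cylinderEvents_mono Set.subset_union_left _ (measurableSet_embeddedSurvival n _))
      (cylinderEvents_mono Set.subset_union_right _ (measurableSet_embeddedSurvival n _))
  have hdisj := (disjoint_level_preimage_Iio_subtree_descend x w).union_right
    (disjoint_level_preimage_Iio_subtree_descend x w')
  rw [← measureReal_embeddedSurvival_inter hx hne,
    ← measureReal_activatedFrom_descend hν hc hq hx w,
    ← measureReal_activatedFrom_descend_inter hdisj hmeas]
  exact measureReal_mono fun ω hω => ⟨hω.1.1, hω.1.2, hω.2.2⟩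

lemma mul_le_measureReal_embeddedSurvival {δ : ℝ} (hν : IsLifetimeLaw d c q ν) (hc : 0 ≤ c)
    (hq : 0 ≤ q) (hN : 0 < renewalSeq (gapProb c q) N) (hδ : 0 ≤ δ)
    (hNδ : renewalSeq (gapProb c q) N * δ ≤ 1)
    (hdδ : 1 ≤ d ^ N * renewalSeq (gapProb c q) N * (1 - d ^ N * δ)) (hx : x ≠ .root) :
    renewalSeq (gapProb c q) N * δ ≤ (frogMeasure d ν).real (embeddedSurvival N n x) := by
  induction n generalizing x with
  | zero => simpa only [embeddedSurvival, probReal_univ]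
  | succ n ih =>
    refine mul_le_measureReal_iUnion (fun w => ?_) hN hδ (by simpa using hdδ)
      (fun w => ih (Vertex.descend_ne_root hx _))
      (fun w => measureReal_activatedFrom_descend_inter_embeddedSurvival hν hc hq hx w)
      (fun w w' => measureReal_inter_activatedFrom_descend_inter_embeddedSurvival_le hν hc hq hx)
    · exact (cylinderEvents_le_pi _ (measurableSet_activatedFrom_descend x w)).inter
        (cylinderEvents_le_pi _ (measurableSet_embeddedSurvival n _))

lemma exists_mul_one_sub_mul_eq_one {b a : ℝ} (hb : 1 ≤ b) (h : 1 < b * a) :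
    ∃ δ, 0 < δ ∧ δ ≤ 1 ∧ b * a * (1 - b * δ) = 1 := by
  have hb0 : 0 < b := zero_lt_one.trans_le hb
  have hab : 0 < b * a := zero_lt_one.trans h
  refine ⟨(1 - (b * a)⁻¹) / b, div_pos (sub_pos.2 (inv_lt_one_of_one_lt₀ h)) hb0, ?_, ?_⟩
  · refine div_le_one_of_le₀ ?_ hb0.le
    linarith [inv_pos.2 hab]
  · rw [mul_div_cancel₀ _ hb0.ne', sub_sub_cancel, mul_inv_cancel₀ hab.ne']

lemma exists_le_measureReal_embeddedSurvival (hν : IsLifetimeLaw d c q ν) (hc : 0 ≤ c)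
    (hq : 0 ≤ q) (hN : 1 < d ^ N * renewalSeq (gapProb c q) N) :
    ∃ ε > 0, ∀ n (x : Vertex d), x ≠ .root →
      ε ≤ (frogMeasure d ν).real (embeddedSurvival N n x) := by
  have hd : 1 ≤ (d : ℝ) ^ N := one_le_pow₀ (Nat.one_le_cast.2 NeZero.one_le)
  have hpos : 0 < renewalSeq (gapProb c q) N :=
    pos_of_mul_pos_right (zero_lt_one.trans hN) (by positivity)
  have hle : renewalSeq (gapProb c q) N ≤ 1 := by
    rw [← measureReal_activatedFrom_descend hν hc hq (x := .node 0 []) nofun fun _ => 0]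
    exact measureReal_le_one
  obtain ⟨δ, hδ, hδ1, hdδ⟩ := exists_mul_one_sub_mul_eq_one hd hN
  exact ⟨_, mul_pos hpos hδ, fun n x => mul_le_measureReal_embeddedSurvival hν hc hq hpos hδ.le
    (mul_le_one₀ hle hδ.le hδ1) hdδ.ge⟩

end EmbeddedProcess

section Survival

variable [NeZero d] {ν : PMF ℕ} {c q : ℝ}

lemma survivalProb_le (t : ℕ) :
    survivalProb d ν ≤ frogMeasure d ν {ω | ∃ y, ActivatedAt ω y t} :=
  measure_mono fun _ h => survives_iff.1 h t

lemma survivalProb_eq_iInf :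
    survivalProb d ν = ⨅ t, frogMeasure d ν {ω | ∃ y, ActivatedAt ω y t} := by
  have hsurvives : {ω : Config d | Survives ω} = ⋂ t, {ω | ∃ y, ActivatedAt ω y t} := by
    ext ω
    simp only [survives_iff, Set.mem_ofPred_eq, Set.mem_iInter]
  have hanti : Antitone fun t => {ω : Config d | ∃ y, ActivatedAt ω y t} :=
    fun _ _ hst _ => exists_activatedAt_of_le hst
  rw [survivalProb, hsurvives, hanti.measure_iInter
    (fun t => (measurableSet_exists_activatedAt t).nullMeasurableSet) ⟨0, measure_ne_top _ _⟩]

lemma measureReal_reachedFrom_one_mul_le {N : ℕ} (n : ℕ) {x : Vertex d} (hx : x.level = 1) :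
    (frogMeasure d ν).real {ω | ReachedFrom ω x 1} *
        (frogMeasure d ν).real (embeddedSurvival N n x) ≤
      (frogMeasure d ν).real {ω | ∃ y, ActivatedAt ω y (1 + n * N)} := by
  have hmeas : MeasurableSet[cylinderEvents (Vertex.level ⁻¹' Set.Iio 1)]
      {ω : Config d | ReachedFrom ω x 1} := by
    refine measurableSet_reachedFrom ?_
    rw [Set.mem_preimage, Vertex.level_ancestor, hx, Set.mem_Iio]
    exact Nat.one_pos
  rw [← measureReal_frogMeasure_inter_of_disjoint
    (Vertex.disjoint_level_preimage_Iio_subtree hx.ge) hmeas (measurableSet_embeddedSurvival n x)]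
  refine measureReal_mono fun ω ⟨hreach, hsurv⟩ => ?_
  have hact : ActivatedFrom ω (0 + 1) x := activatedFrom_zero.of_reachedFrom hreach
  exact exists_activatedAt_of_mem_embeddedSurvival hsurv (activatedAt_iff.2 ⟨hx, hact⟩)

lemma survivalProb_pos (hν : IsLifetimeLaw d c q ν) (hc : 0 < c) (hq : 0 < q) {N : ℕ}
    (hN : 1 < d ^ N * renewalSeq (gapProb c q) N) : 0 < survivalProb d ν := by
  have hN0 : N ≠ 0 := by
    rintro rfl
    simp at hN
  obtain ⟨ε, hε, hsurv⟩ := exists_le_measureReal_embeddedSurvival hν hc.le hq.le hN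
  have hreach := measureReal_reachedFrom_one_pos hν hc hq (y := .node 0 []) rfl
  rw [survivalProb_eq_iInf]
  refine (ENNReal.ofReal_pos.2 (mul_pos hreach hε)).trans_le (le_iInf fun t => ?_)
  rw [ENNReal.ofReal_le_iff_le_toReal (measure_ne_top _ _)]
  calc (frogMeasure d ν).real {ω | ReachedFrom ω (.node 0 []) 1} * ε
      ≤ (frogMeasure d ν).real {ω | ReachedFrom ω (.node 0 []) 1} *
          (frogMeasure d ν).real (embeddedSurvival N t (.node 0 [])) := by
        gcongr
        exact hsurv t _ nofun
    _ ≤ (frogMeasure d ν).real {ω | ∃ y, ActivatedAt ω y (1 + t * N)} :=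
        measureReal_reachedFrom_one_mul_le t rfl
    _ ≤ (frogMeasure d ν).real {ω | ∃ y, ActivatedAt ω y t} := by
        refine measureReal_mono fun ω => exists_activatedAt_of_le ?_
        exact (Nat.le_mul_of_pos_right t (Nat.pos_of_ne_zero hN0)).trans (Nat.le_add_left _ _)

lemma measureReal_exists_activatedAt_succ_le (hν : IsLifetimeLaw d c q ν) (hc : 0 ≤ c)
    (hq : 0 ≤ q) (n : ℕ) :
    (frogMeasure d ν).real {ω | ∃ y, ActivatedAt ω y (n + 1)} ≤
      (d + 1) * d ^ n * renewalSeq (gapProb c q) (n + 1) := by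
  calc (frogMeasure d ν).real {ω | ∃ y, ActivatedAt ω y (n + 1)}
      ≤ (frogMeasure d ν).real (⋃ z : Fin (d + 1) × (Fin n → Fin d),
          {ω | ActivatedFrom ω (n + 1) (.node z.1 (List.ofFn z.2))}) := by
        refine measureReal_mono ?_
        rintro ω ⟨y, hy⟩
        obtain ⟨i, w, rfl⟩ := Vertex.exists_eq_node_of_level_eq hy.level_eq
        exact Set.mem_iUnion.2 ⟨(i, w), hy.activatedFrom⟩
    _ ≤ ∑ z : Fin (d + 1) × (Fin n → Fin d),
          (frogMeasure d ν).real {ω | ActivatedFrom ω (n + 1) (.node z.1 (List.ofFn z.2))} :=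
        measureReal_iUnion_fintype_le _
    _ ≤ ∑ _z : Fin (d + 1) × (Fin n → Fin d), renewalSeq (gapProb c q) (n + 1) :=
        Finset.sum_le_sum fun z _ =>
          measureReal_activatedFrom_le hν hc hq (by simp [Vertex.level])
    _ = (d + 1) * d ^ n * renewalSeq (gapProb c q) (n + 1) := by simp

lemma survivalProb_eq_zero (hν : IsLifetimeLaw d c q ν) (hc : 0 ≤ c) (hq : 0 ≤ q)
    (h : Tendsto (fun n => (d : ℝ) ^ n * renewalSeq (gapProb c q) n) atTop (𝓝 0)) :
    survivalProb d ν = 0 := by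
  have hd : (d : ℝ) ≠ 0 := Nat.cast_ne_zero.2 (NeZero.ne d)
  have hbound : Tendsto (fun n => (d + 1 : ℝ) * d ^ n * renewalSeq (gapProb c q) (n + 1))
      atTop (𝓝 0) := by
    rw [← mul_zero ((d + 1 : ℝ) / d)]
    refine (((tendsto_add_atTop_iff_nat 1).2 h).const_mul _).congr fun n => ?_
    field_simp
    ring
  have hle : (survivalProb d ν).toReal ≤ 0 := ge_of_tendsto' hbound fun n =>
    (ENNReal.toReal_mono (measure_ne_top _ _) (survivalProb_le (n + 1))).trans
      (measureReal_exists_activatedAt_succ_le hν hc hq n)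
  exact (measureReal_eq_zero_iff (measure_ne_top _ _)).1 (hle.antisymm ENNReal.toReal_nonneg)

end Survival

section CriticalParameter

variable {c q : ℝ} {ν : PMF ℕ}

lemma renewalSeq_seriesTerm (b c q : ℝ) :
    renewalSeq (seriesTerm b c q) = fun n => b ^ n * renewalSeq (gapProb c q) n := by
  ext n
  rw [seriesTerm_eq_pow_mul_gapProb, renewalSeq_pow_mul]

variable [NeZero d]

lemma survivalProb_eq_zero_of_tsum_seriesTerm_lt_one (hc : c ∈ Set.Ioc (0 : ℝ) 1)
    (hq : q ∈ Set.Ico (0 : ℝ) (1 / d)) (hν : IsLifetimeLaw d c q ν)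
    (h : ∑' k, seriesTerm d c q k < 1) : survivalProb d ν = 0 := by
  have hd : (1 : ℝ) ≤ d := Nat.one_le_cast.2 NeZero.one_le
  have hc' : c ∈ Set.Icc (0 : ℝ) 1 := Set.Ioc_subset_Icc_self hc
  have hsum := summable_renewalSeq
    (seriesTerm_nonneg (zero_le_one.trans hd) hc' (mem_Icc_zero_one_of_mem_Ico hd hq))
    (summable_seriesTerm hd hc' hq) h
  refine survivalProb_eq_zero hν hc.1.le hq.1 ?_
  rw [← renewalSeq_seriesTerm]
  exact hsum.tendsto_atTop_zero

lemma survivalProb_pos_of_one_lt_tsum_seriesTerm (hc : c ∈ Set.Ioc (0 : ℝ) 1)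
    (hq : q ∈ Set.Ioo (0 : ℝ) (1 / d)) (hν : IsLifetimeLaw d c q ν)
    (h : 1 < ∑' k, seriesTerm d c q k) : 0 < survivalProb d ν := by
  have hd : (1 : ℝ) ≤ d := Nat.one_le_cast.2 NeZero.one_le
  have hc' : c ∈ Set.Icc (0 : ℝ) 1 := Set.Ioc_subset_Icc_self hc
  have hq' : q ∈ Set.Ico (0 : ℝ) (1 / d) := Set.Ioo_subset_Ico_self hq
  obtain ⟨K, hK⟩ := ((summable_seriesTerm hd hc' hq').tendsto_sum_tsum_nat.eventually
    (lt_mem_nhds h)).exists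
  obtain ⟨N, hN⟩ := exists_one_lt_renewalSeq
    (seriesTerm_nonneg (zero_le_one.trans hd) hc' (mem_Icc_zero_one_of_mem_Ico hd hq')) hK
  rw [renewalSeq_seriesTerm] at hN
  exact survivalProb_pos hν hc.1 hq.1 hN

/-- The set whose infimum is the critical parameter: the parameters at which the model is defined
and survives with positive probability. -/
def supercriticalSet (d : ℕ) [NeZero d] (c : ℝ) : Set ℝ :=
  {q : ℝ | 0 < q ∧ q < 1 ∧ (∀ n : ℕ, 1 ≤ n → c * (d * q) ^ n < 1) ∧
    ∃ ν : PMF ℕ, IsLifetimeLaw d c q ν ∧ 0 < survivalProb d ν}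

lemma mem_supercriticalSet_of_one_lt_tsum_seriesTerm (hc : c ∈ Set.Ioc (0 : ℝ) 1)
    (hq : q ∈ Set.Ioo (0 : ℝ) (1 / d)) (h : 1 < ∑' k, seriesTerm d c q k) :
    q ∈ supercriticalSet d c := by
  have hd : (1 : ℝ) ≤ d := Nat.one_le_cast.2 NeZero.one_le
  have hdq0 : 0 ≤ d * q := mul_nonneg (zero_le_one.trans hd) hq.1.le
  have hdq : d * q < 1 := (lt_div_iff₀' (zero_lt_one.trans_le hd)).1 hq.2
  obtain ⟨ν, hν⟩ := exists_isLifetimeLaw hc.1 hc.2 hdq0 hdq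
  refine ⟨hq.1, hq.2.trans_le (div_le_one_of_le₀ hd (zero_le_one.trans hd)), fun n hn => ?_, ν, hν,
    survivalProb_pos_of_one_lt_tsum_seriesTerm hc hq hν h⟩
  exact (mul_le_of_le_one_left (pow_nonneg hdq0 n) hc.2).trans_lt
    (pow_lt_one₀ hdq0 hdq (Nat.one_le_iff_ne_zero.1 hn))

lemma le_of_mem_supercriticalSet (hd : 2 ≤ d) (hc : c ∈ Set.Ioc (0 : ℝ) 1)
    (hq : q ∈ Set.Ioo (0 : ℝ) (1 / d)) (h : ∑' k, seriesTerm d c q k = 1) {x : ℝ}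
    (hx : x ∈ supercriticalSet d c) : q ≤ x := by
  obtain ⟨hx0, -, -, ν, hν, hpos⟩ := hx
  by_contra! hxq
  have hx' : x ∈ Set.Ico (0 : ℝ) (1 / d) := ⟨hx0.le, hxq.trans hq.2⟩
  refine hpos.ne' (survivalProb_eq_zero_of_tsum_seriesTerm_lt_one hc hx' hν ?_)
  rw [← h]
  exact strictMonoOn_tsum_seriesTerm (Nat.ofNat_le_cast.2 hd) hc hx' (Set.Ioo_subset_Ico_self hq)
    hxq

lemma criticalParam_eq (hd : 2 ≤ d) (hc : c ∈ Set.Ioc (0 : ℝ) 1)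
    (hq : q ∈ Set.Ioo (0 : ℝ) (1 / d)) (h : ∑' k, seriesTerm d c q k = 1) :
    criticalParam d c = q := by
  have hd2 : (2 : ℝ) ≤ d := Nat.ofNat_le_cast.2 hd
  have hmem {x : ℝ} (hqx : q < x) (hx : x < 1 / d) : x ∈ supercriticalSet d c := by
    refine mem_supercriticalSet_of_one_lt_tsum_seriesTerm hc ⟨hq.1.trans hqx, hx⟩ ?_
    rw [← h]
    exact strictMonoOn_tsum_seriesTerm hd2 hc (Set.Ioo_subset_Ico_self hq)
      ⟨(hq.1.trans hqx).le, hx⟩ hqx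
  refine csInf_eq_of_forall_ge_of_forall_gt_exists_lt (s := supercriticalSet d c) ?_
    (fun x hx => le_of_mem_supercriticalSet hd hc hq h hx) fun x hqx => ?_
  · obtain ⟨x, hqx, hx⟩ := exists_between hq.2
    exact ⟨x, hmem hqx hx⟩
  · obtain ⟨z, hqz, hz⟩ := exists_between (lt_min hqx hq.2)
    exact ⟨z, hmem hqz (hz.trans_le (min_le_right _ _)), hz.trans_le (min_le_left _ _)⟩

end CriticalParameter

end FrogModel

end

theorem theorem1 (d : ℕ) [NeZero d] (hd : 2 ≤ d) (c : ℝ) (hc : c ∈ Set.Ioc (0 : ℝ) 1) :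
    HasSum (fun k : ℕ => c * (d * FrogModel.criticalParam d c) ^ (k + 1) *
        ∏ i ∈ Finset.Icc 1 k, (1 - c * FrogModel.criticalParam d c ^ i)) 1 ∧
      (∀ q ∈ Set.Ioo (0 : ℝ) 1,
        HasSum (fun k : ℕ => c * (d * q) ^ (k + 1) *
          ∏ i ∈ Finset.Icc 1 k, (1 - c * q ^ i)) 1 → q = FrogModel.criticalParam d c) ∧
      FrogModel.criticalParam d c ∈ Set.Ioo (0 : ℝ) (1 / d) := by
  have hd1 : (1 : ℝ) < d := Nat.one_lt_cast.2 hd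
  obtain ⟨x, hx, hsum⟩ := FrogModel.exists_tsum_seriesTerm_eq_one hd1 hc
  have hsummable : Summable (FrogModel.seriesTerm d c x) :=
    FrogModel.summable_seriesTerm hd1.le (Set.Ioc_subset_Icc_self hc) (Set.Ioo_subset_Ico_self hx)
  rw [FrogModel.criticalParam_eq hd hc hx hsum]
  refine ⟨hsummable.hasSum_iff.2 hsum, fun q hq hasSum => ?_, hx⟩
  have hdq : d * q < 1 := not_le.1 fun h =>
    FrogModel.not_summable_seriesTerm hc (Set.Ioo_subset_Ico_self hq) h hasSum.summable
  have hq' : q ∈ Set.Ico (0 : ℝ) (1 / d) :=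
    ⟨hq.1.le, (lt_div_iff₀' (zero_lt_one.trans hd1)).2 hdq⟩
  exact (FrogModel.strictMonoOn_tsum_seriesTerm (Nat.ofNat_le_cast.2 hd) hc).injOn hq'
    (Set.Ioo_subset_Ico_self hx) (hasSum.tsum_eq.trans hsum.symm)
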